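/- For $G \in \{\mathrm{U}, \mathrm{Sp}, \mathrm{O}, \mathrm{SO(even)}, \mathrm{SO(odd)}\}$ let $W_G$ be the density on $\mathbb{R}$ given by $$W_{\mathrm U}(x) = 1, \quad W_{\mathrm{Sp}}(x) = 1 - \frac{\sin 2\pi x}{2\pi x}, \quad W_{\mathrm O}(x) = 1 + \tfrac12 \boldsymbol\delta_0(x),$$ $$W_{\mathrm{SO(even)}}(x) = 1 + \frac{\sin 2\pi x}{2\pi x}, \quad W_{\mathrm{SO(odd)}}(x) = 1 - \frac{\sin 2\pi x}{2\pi x} + \boldsymbol\delta_0(x),$$ where $\boldsymbol\delta_0$ is the Dirac measure at $0$. For $\Delta > 0$ let $\mathcal{H}_{G,\pi\Delta}$ be the space of entire functions $F$ of exponential type at most $\pi\Delta$, i.e. $\limsup_{|z|\to\infty} |z|^{-1}\log|F(z)| \le \pi\Delta$, such that $\int_{\mathbb R} |F(x)|^2\, W_G(x)\,dx < \infty$. This space has a unique reproducing kernel $K_{G,\pi\Delta} : \mathbb{C}\times\mathbb{C} \to \mathbb{C}$, i.e. for every $w \in \mathbb{C}$ the function $K_{G,\pi\Delta}(w,\cdot)$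 belongs to $\mathcal{H}_{G,\pi\Delta}$ and $F(w) = \int_{\mathbb R} F(x)\, \overline{K_{G,\pi\Delta}(w,x)}\, W_G(x)\,dx$ for all $F \in \mathcal{H}_{G,\pi\Delta}$. Its values at the origin are as follows. (i) For every $\Delta > 0$, $K_{\mathrm U,\pi\Delta}(0,0) = \Delta$ and $K_{\mathrm O,\pi\Delta}(0,0) = \dfrac{2\Delta}{2+\Delta}$. (ii) $K_{\mathrm{SO(even)},\pi\Delta}(0,0) = \dfrac{2\Delta}{2+\Delta}$ if $0 < \Delta \le 1$, and $$K_{\mathrm{SO(even)},\pi\Delta}(0,0) = 2 - \frac{4\cos\left(\frac{\Delta-1}{2}\right)}{4 + 4\sin\left(\frac{\Delta-1}{2}\right) - \Delta\cos\left(\frac{\Delta-1}{2}\right)} \quad \text{if } 1 < \Delta \le 2.$$ (iii) $K_{\mathrm{Sp},\pi\Delta}(0,0) = \dfrac{2\Delta}{2-\Delta}$ if $0 < \Delta \le 1$, and $$K_{\mathrm{Sp},\pi\Delta}(0,0) = \frac{4\cos\left(\frac{\Delta-1}{2}\right)}{4 - 4\sin\left(\frac{\Delta-1}{2}\right) - (4-\Delta)\cos\left(\frac{\Delta-1}{2}\right)}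 - 2 \quad \text{if } 1 < \Delta \le 2.$$ (iv) $K_{\mathrm{SO(odd)},\pi\Delta}(0,0) = \dfrac{2\Delta}{2+\Delta}$ if $0 < \Delta \le 1$, and $$K_{\mathrm{SO(odd)},\pi\Delta}(0,0) = 2 + \frac{4\cos\left(\frac{\Delta-1}{2}\right)}{4 - 4\sin\left(\frac{\Delta-1}{2}\right) - (8-\Delta)\cos\left(\frac{\Delta-1}{2}\right)} \quad \text{if } 1 < \Delta \le 2.$$ -/

import Mathlib

open MeasureTheory

/-- The five Katz–Sarnak symmetry types. -/
inductive SymmetryGroup : Type where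
  | U
  | Sp
  | O
  | SOeven
  | SOodd

/-- The one-level density `W_G`, viewed as a (positive) measure on `ℝ`; the Dirac distribution at
the origin is the Dirac measure. `Real.sinc y` is `sin y / y`, with value `1` at `y = 0`. -/
noncomputable def densityMeasure : SymmetryGroup → Measure ℝ
  | .U => volume
  | .Sp => volume.withDensity
      (fun x : ℝ => ENNReal.ofReal (1 - Real.sinc (2 * Real.pi * x)))
  | .O => volume + (1 / 2 : ENNReal) • Measure.dirac (0 : ℝ)
  | .SOeven => volume.withDensity
      (fun x : ℝ => ENNReal.ofReal (1 + Real.sinc (2 * Real.pi * x)))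
  | .SOodd => volume.withDensity
      (fun x : ℝ => ENNReal.ofReal (1 - Real.sinc (2 * Real.pi * x))) + Measure.dirac (0 : ℝ)

/-- The exponential type `τ(F) = limsup_{|z| → ∞} |z|⁻¹ log |F z|`, an extended real number
(`log 0 = -∞`). -/
noncomputable def exponentialType (F : ℂ → ℂ) : EReal :=
  Filter.limsup (fun z : ℂ => ((‖z‖⁻¹ : ℝ) : EReal) * ENNReal.log ‖F z‖ₑ)
    (Bornology.cobounded ℂ)

/-- Membership in `H_{G, πΔ}`: the entire functions of exponential type at most `πΔ` whose
restriction to `ℝ` is square-integrable with respect to `W_G`. -/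
def MemHilbert (G : SymmetryGroup) (Δ : ℝ) (F : ℂ → ℂ) : Prop :=
  Differentiable ℂ F ∧ exponentialType F ≤ ((Real.pi * Δ : ℝ) : EReal) ∧
    MemLp (fun x : ℝ => F (x : ℂ)) 2 (densityMeasure G)

/-- `K` is a reproducing kernel of `H_{G, πΔ}`: each `K w` belongs to the space, and evaluation at
`w` is the inner product with `K w`. -/
def IsReproducingKernel (G : SymmetryGroup) (Δ : ℝ) (K : ℂ → ℂ → ℂ) : Prop :=
  ∀ w : ℂ, MemHilbert G Δ (K w) ∧
    ∀ F : ℂ → ℂ, MemHilbert G Δ F →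
      F w = ∫ x : ℝ, F (x : ℂ) * (starRingEnd ℂ) (K w (x : ℂ)) ∂(densityMeasure G)

open Classical in
/-- The reproducing kernel `K_{G, πΔ}`, as a function of `w` and `z`. -/
noncomputable def reproducingKernel (G : SymmetryGroup) (Δ : ℝ) : ℂ → ℂ → ℂ :=
  if h : ∃ K : ℂ → ℂ → ℂ, IsReproducingKernel G Δ K then h.choose else 0

open MeasureTheory

/-! Each density has the form 1 + ε sinc(2πx) plus an atom of mass m at 0, with |ε| ≤ 1
(`weightMeasure`). Put a = Δ/2. As sets, all the spaces equal the Paley–Wiener space of transforms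
of L² functions supported in [-a, a] (`memHilbert_iff`, resting on `exists_eq_fourierLaplace`). The
weighted norm is equivalent to the L² norm there: the weight can vanish only at the origin, where a
band-limited function cannot concentrate (`exists_le_integral_norm_sq_weightMeasure`). Riesz
representation then gives the kernel, and its Hermitian symmetry gives uniqueness.

Since sinc(2πx) is the transform of half the indicator of [-1, 1], Plancherel turns the reproducing
property at 0, without the atom, into the integral equation φ(t) + (ε/2) ∫_{t-1}^{t+1} φ = 1 on [-a,
a], and the kernel value is k = ∫ φ. The atom is a rank-one perturbation that changes k into k/(1 +
mk) (`reproducingKernel_zero_zero`).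

For ε = 0, or for Δ ≤ 1, the solution φ is constant on [-a, a]. For ε = ±1 and 1 < Δ ≤ 2 it is
constant on |t| ≤ 1 - a, while on 1 - a ≤ t ≤ a differentiation gives φ'(t) = (ε/2) φ(1 - t).
Centred at t = 1/2, this reflected equation is solved by cos(s/2) + ε sin(s/2)
(`reproducingKernel_of_profile`). Half-angle identities produce the closed forms. -/

/-! ### Plancherel for integrable, square-integrable functions -/

open scoped FourierTransform SchwartzMap ContDiff in
theorem integral_schwartz_mul_fourier_Lp (u : Lp ℂ 2 (volume : Measure ℝ)) (ψ : 𝓢(ℝ, ℂ)) :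
    ∫ x, ψ x * (𝓕 u : Lp ℂ 2 (volume : Measure ℝ)) x = ∫ x, 𝓕 (ψ : ℝ → ℂ) x * u x := by
  have h := congrArg (fun T : 𝓢'(ℝ, ℂ) => T ψ) (Lp.fourier_toTemperedDistribution_eq u)
  simp only [TemperedDistribution.fourier_apply, Lp.toTemperedDistribution_apply,
    smul_eq_mul] at h
  rw [← h, SchwartzMap.fourier_coe]

open scoped FourierTransform SchwartzMap ContDiff in
theorem integral_schwartz_mul_fourierInv_Lp (u : Lp ℂ 2 (volume : Measure ℝ)) (ψ : 𝓢(ℝ, ℂ)) :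
    ∫ x, ψ x * (𝓕⁻ u : Lp ℂ 2 (volume : Measure ℝ)) x = ∫ x, 𝓕⁻ (ψ : ℝ → ℂ) x * u x := by
  have h := congrArg (fun T : 𝓢'(ℝ, ℂ) => T ψ) (Lp.fourierInv_toTemperedDistribution_eq u)
  simp only [TemperedDistribution.fourierInv_apply, Lp.toTemperedDistribution_apply,
    smul_eq_mul] at h
  rw [← h, SchwartzMap.fourierInv_coe]

open scoped FourierTransform in
theorem integral_fourier_mul_eq_flip {f g : ℝ → ℂ} (hf : Integrable f) (hg : Integrable g) :
    ∫ x, 𝓕 f x * g x = ∫ x, f x * 𝓕 g x := by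
  have := VectorFourier.integral_fourierIntegral_smul_eq_flip (L := innerₗ ℝ)
    Real.continuous_fourierChar (by simpa using continuous_inner (𝕜 := ℝ) (E := ℝ)) hf hg
  rw [flip_innerₗ] at this
  exact this

open scoped FourierTransform in
theorem integral_fourierInv_mul_eq_flip {f g : ℝ → ℂ} (hf : Integrable f) (hg : Integrable g) :
    ∫ x, 𝓕⁻ f x * g x = ∫ x, f x * 𝓕⁻ g x := by
  simp_rw [Real.fourierInv_eq_fourier_comp_neg g]
  rw [← integral_fourier_mul_eq_flip hf (by simpa using hg.comp_neg),
    ← integral_neg_eq_self (fun x => 𝓕 f x * g (-x))]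
  simp [Real.fourierInv_eq_fourier_neg]

/-- A smooth compactly supported real function, as a complex Schwartz function. -/
noncomputable def testSchwartz (χ : ℝ → ℝ) (h : ContDiff ℝ (⊤ : ℕ∞) χ) (hc : HasCompactSupport χ) :
    SchwartzMap ℝ ℂ :=
  HasCompactSupport.toSchwartzMap (f := fun x => ((χ x : ℝ) : ℂ))
    (hc.comp_left (g := fun x : ℝ => (x : ℂ)) (by simp))
    (Complex.ofRealCLM.contDiff.comp h)

theorem testSchwartz_apply (χ : ℝ → ℝ) (h : ContDiff ℝ (⊤ : ℕ∞) χ) (hc : HasCompactSupport χ)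
    (x : ℝ) : testSchwartz χ h hc x = (χ x : ℂ) := rfl

-- Both sides have the same integrals against smooth compactly supported functions: the L² transform
-- is tested through tempered distributions, the pointwise integral through Fubini.
open scoped FourierTransform in
theorem fourierInv_toLp_ae_eq {g : ℝ → ℂ} (h1 : Integrable g) (h2 : MemLp g 2) :
    ((𝓕⁻ (h2.toLp g) : Lp ℂ 2 (volume : Measure ℝ)) : ℝ → ℂ) =ᵐ[volume] 𝓕⁻ g := by
  refine ae_eq_of_integral_contDiff_smul_eq ((Lp.memLp _).locallyIntegrable (by norm_num))
    ?_ ?_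
  · have : Continuous (𝓕⁻ g) := by
      rw [Real.fourierInv_eq_fourier_comp_neg]
      exact VectorFourier.fourierIntegral_continuous Real.continuous_fourierChar
        (by simpa using continuous_inner (𝕜 := ℝ) (E := ℝ)) (by simpa using h1.comp_neg)
    exact this.locallyIntegrable
  · intro χ hχ hc
    have h := integral_schwartz_mul_fourierInv_Lp (h2.toLp g) (testSchwartz χ hχ hc)
    simp only [testSchwartz_apply] at h
    simp only [Complex.real_smul]
    rw [h, integral_congr_ae (g := fun x => 𝓕⁻ (testSchwartz χ hχ hc : ℝ → ℂ) x * g x),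
      integral_fourierInv_mul_eq_flip (SchwartzMap.integrable _) h1]
    · rfl
    · filter_upwards [h2.coeFn_toLp] with x hx
      rw [hx]

open scoped FourierTransform in
theorem memLp_fourierInv {g : ℝ → ℂ} (h1 : Integrable g) (h2 : MemLp g 2) :
    MemLp (𝓕⁻ g) 2 :=
  (memLp_congr_ae (fourierInv_toLp_ae_eq h1 h2)).1 (Lp.memLp _)

open scoped FourierTransform ComplexInnerProductSpace ComplexConjugate in
theorem integral_fourierInv_mul_conj {f g : ℝ → ℂ} (hf1 : Integrable f) (hf2 : MemLp f 2)
    (hg1 : Integrable g) (hg2 : MemLp g 2) :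
    ∫ x, 𝓕⁻ f x * conj (𝓕⁻ g x) = ∫ x, f x * conj (g x) := by
  have h : ⟪𝓕⁻ (hg2.toLp g), 𝓕⁻ (hf2.toLp f)⟫ = ⟪hg2.toLp g, hf2.toLp f⟫ :=
    (Lp.fourierTransformₗᵢ ℝ ℂ).symm.inner_map_map _ _
  rw [L2.inner_def, L2.inner_def] at h
  simp only [RCLike.inner_apply] at h
  have hl : ∫ x, 𝓕⁻ f x * conj (𝓕⁻ g x) = ∫ x, (𝓕⁻ (hf2.toLp f) : Lp ℂ 2 (volume : Measure ℝ)) x *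
      conj ((𝓕⁻ (hg2.toLp g) : Lp ℂ 2 (volume : Measure ℝ)) x) := by
    refine integral_congr_ae ?_
    filter_upwards [fourierInv_toLp_ae_eq hf1 hf2, fourierInv_toLp_ae_eq hg1 hg2] with x h1 h2
    rw [h1, h2]
  rw [hl, h]
  refine integral_congr_ae ?_
  filter_upwards [hf2.coeFn_toLp, hg2.coeFn_toLp] with x h1 h2
  rw [h1, h2]

/-! ### Exponential type and pointwise growth -/

theorem exponentialType_le_of_norm_le {F : ℂ → ℂ} {C τ : ℝ} (hC : 0 < C)
    (h : ∀ z, ‖F z‖ ≤ C * Real.exp (τ * ‖z‖)) : exponentialType F ≤ (τ : EReal) := by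
  refine EReal.le_of_forall_lt_iff_le.1 fun b hb => ?_
  rw [EReal.coe_lt_coe_iff] at hb
  refine Filter.limsup_le_of_le (by isBoundedDefault) ?_
  have h1 : ∀ᶠ z : ℂ in Bornology.cobounded ℂ, max 1 (Real.log C / (b - τ)) ≤ ‖z‖ :=
    tendsto_norm_cobounded_atTop.eventually_ge_atTop _
  filter_upwards [h1] with z hz
  have hz1 : 1 ≤ ‖z‖ := (le_max_left _ _).trans hz
  have hz2 : Real.log C / (b - τ) ≤ ‖z‖ := (le_max_right _ _).trans hz
  have hz0 : 0 < ‖z‖ := by linarith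
  have hF : ENNReal.log ‖F z‖ₑ ≤ ((b * ‖z‖ : ℝ) : EReal) := by
    rw [← Real.log_exp (b * ‖z‖), ← ENNReal.log_ofReal_of_pos (Real.exp_pos _),
      ENNReal.log_le_log_iff, ← ofReal_norm]
    refine ENNReal.ofReal_le_ofReal ((h z).trans ?_)
    rw [← Real.exp_log hC, ← Real.exp_add, Real.exp_le_exp]
    rw [div_le_iff₀ (by linarith)] at hz2
    nlinarith
  calc ((‖z‖⁻¹ : ℝ) : EReal) * ENNReal.log ‖F z‖ₑ
      ≤ ((‖z‖⁻¹ : ℝ) : EReal) * ((b * ‖z‖ : ℝ) : EReal) := by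
        gcongr
    _ = (b : EReal) := by
        rw [← EReal.coe_mul]
        congr 1
        field_simp

/-- The limsup gives the bound outside some disc, at the cost of the slack b > τ; compactness of the
disc supplies the constant inside. -/
theorem exists_norm_le_of_exponentialType_le {F : ℂ → ℂ} (hF : Continuous F) {τ b : ℝ}
    (h : exponentialType F ≤ (τ : EReal)) (hb : τ < b) :
    ∃ C, 0 ≤ C ∧ ∀ z, ‖F z‖ ≤ C * Real.exp (b * ‖z‖) := by
  have h1 : ∀ᶠ z : ℂ in Bornology.cobounded ℂ,
      ((‖z‖⁻¹ : ℝ) : EReal) * ENNReal.log ‖F z‖ₑ < (b : EReal) :=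
    Filter.eventually_lt_of_limsup_lt (h.trans_lt (by exact_mod_cast hb)) (by isBoundedDefault)
  have h2 := h1.and (tendsto_norm_cobounded_atTop.eventually_gt_atTop 0)
  obtain ⟨R, -, hR⟩ := (Metric.hasBasis_cobounded_compl_closedBall (0 : ℂ)).eventually_iff.1 h2
  obtain ⟨M, hM⟩ := (isCompact_closedBall (0 : ℂ) R).exists_bound_of_continuousOn
    (f := fun z => F z * Real.exp (-(b * ‖z‖))) (by fun_prop)
  refine ⟨max M 1, by positivity, fun z => ?_⟩
  by_cases hz : z ∈ Metric.closedBall (0 : ℂ) R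
  · have := hM z hz
    rw [norm_mul, Complex.norm_real, Real.norm_of_nonneg (Real.exp_pos _).le, Real.exp_neg,
      ← div_eq_mul_inv, div_le_iff₀ (Real.exp_pos _)] at this
    exact this.trans (by gcongr; exact le_max_left _ _)
  · obtain ⟨h3, h4⟩ := hR hz
    have h5 : ‖F z‖ ≤ Real.exp (b * ‖z‖) := by
      by_contra! hlt
      have h6 : ((b * ‖z‖ : ℝ) : EReal) ≤ ENNReal.log ‖F z‖ₑ := by
        rw [← Real.log_exp (b * ‖z‖), ← ENNReal.log_ofReal_of_pos (Real.exp_pos _),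
          ENNReal.log_le_log_iff, ← ofReal_norm]
        exact ENNReal.ofReal_le_ofReal hlt.le
      have h7 : ((‖z‖⁻¹ : ℝ) : EReal) * ((b * ‖z‖ : ℝ) : EReal)
          ≤ ((‖z‖⁻¹ : ℝ) : EReal) * ENNReal.log ‖F z‖ₑ := by
        gcongr
      rw [← EReal.coe_mul, show ‖z‖⁻¹ * (b * ‖z‖) = b by field_simp] at h7
      exact absurd h3 (not_lt.2 h7)
    calc ‖F z‖ ≤ 1 * Real.exp (b * ‖z‖) := by rwa [one_mul]
      _ ≤ _ := by gcongr; exact le_max_right _ _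

/-! ### Contour integrals and Phragmén–Lindelöf bounds -/

theorem integrable_of_norm_le_div_one_add_sq {f : ℝ → ℂ} (hf : Continuous f) {C : ℝ}
    (h : ∀ x, ‖f x‖ ≤ C / (1 + x ^ 2)) : Integrable f := by
  refine (integrable_inv_one_add_sq.const_mul C).mono' hf.aestronglyMeasurable
    (Filter.Eventually.of_forall fun x => ?_)
  simpa [div_eq_mul_inv] using h x

/-- A function holomorphic on the closed lower half-plane and decaying like `‖z‖⁻²` has vanishing
integral along the real line. -/
theorem integral_eq_zero_of_decay_lower_half_plane {H : ℂ → ℂ} {C : ℝ}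
    (hd : ∀ z : ℂ, z.im ≤ 0 → DifferentiableAt ℂ H z)
    (hb : ∀ z : ℂ, z.im ≤ 0 → ‖H z‖ ≤ C / (1 + ‖z‖ ^ 2)) :
    Integrable (fun x : ℝ => H x) ∧ ∫ x : ℝ, H x = 0 := by
  have hC : 0 ≤ C := by
    have := (norm_nonneg _).trans (hb 0 (by simp))
    simpa using this
  have hcont : Continuous fun x : ℝ => H x := continuous_iff_continuousAt.2 fun x =>
    (hd x (by simp)).continuousAt.comp Complex.continuous_ofReal.continuousAt
  have hint : Integrable (fun x : ℝ => H x) :=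
    integrable_of_norm_le_div_one_add_sq (C := C) hcont fun x => by
      simpa using hb x (by simp)
  refine ⟨hint, ?_⟩
  have hlim := intervalIntegral_tendsto_integral hint Filter.tendsto_neg_atTop_atBot
    (Filter.tendsto_id (α := ℝ))
  -- Cauchy on the rectangle with corners -R - iR and R: the three lower sides have total length 4R
  -- and the integrand there is at most C/R².
  refine tendsto_nhds_unique hlim (squeeze_zero_norm' (a := fun R : ℝ => 4 * C * R⁻¹) ?_ ?_)
  · filter_upwards [Filter.eventually_gt_atTop 0] with R hR
    have hrect := Complex.integral_boundary_rect_eq_zero_of_differentiableOn H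
      ⟨-R, -R⟩ ⟨R, 0⟩ (fun z hz => (hd z ?_).differentiableWithinAt)
    · simp only [Complex.ofReal_zero, zero_mul, add_zero] at hrect
      have side : ∀ z : ℂ, z.im ≤ 0 → R ≤ ‖z‖ → ‖H z‖ ≤ C / R ^ 2 := fun z hz hzR =>
        (hb z hz).trans (by gcongr; nlinarith)
      have b1 : ‖∫ x : ℝ in (-R)..R, H (x + ((-R : ℝ) : ℂ) * Complex.I)‖
          ≤ C / R ^ 2 * |R - (-R)| := by
        refine intervalIntegral.norm_integral_le_of_norm_le_const fun x _ => side _ ?_ ?_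
        · simp [hR.le]
        · refine le_trans ?_ (Complex.abs_im_le_norm _)
          simp [abs_of_pos hR]
      have b2 : ∀ c : ℝ, |c| = R → ‖∫ y : ℝ in (-R)..0, H (c + y * Complex.I)‖
          ≤ C / R ^ 2 * |0 - (-R)| := by
        intro c hc
        refine intervalIntegral.norm_integral_le_of_norm_le_const fun y hy => side _ ?_ ?_
        · rw [Set.uIoc_of_le (by linarith)] at hy
          simpa using hy.2
        · refine le_trans ?_ (Complex.abs_re_le_norm _)
          simp [hc]
      have b3 := b2 R (abs_of_pos hR)
      have b4 := b2 (-R) (by rw [abs_neg, abs_of_pos hR])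
      have e : ∫ x : ℝ in (-R)..R, H x =
          (∫ x : ℝ in (-R)..R, H (x + ((-R : ℝ) : ℂ) * Complex.I))
          + Complex.I • (∫ y : ℝ in (-R)..0, H ((R : ℝ) + y * Complex.I))
          - Complex.I • ∫ y : ℝ in (-R)..0, H (((-R : ℝ) : ℂ) + y * Complex.I) := by
        linear_combination -hrect
      simp only [id]
      rw [e]
      refine (norm_sub_le _ _).trans ((add_le_add_left (norm_add_le _ _) _).trans ?_)
      rw [norm_smul, norm_smul, Complex.norm_I, one_mul, one_mul]
      rw [sub_neg_eq_add, abs_of_pos (by linarith)] at b1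
      rw [zero_sub, neg_neg, abs_of_pos hR] at b3 b4
      have : C / R ^ 2 * (R + R) + C / R ^ 2 * R + C / R ^ 2 * R = 4 * C * R⁻¹ := by
        field_simp; ring
      linarith
    · have h2 := hz.2
      simp only [Set.mem_preimage] at h2
      rw [Set.uIcc_of_le (by simpa using hR.le)] at h2
      exact h2.2
  · simpa using tendsto_inv_atTop_zero.const_mul (4 * C)

theorem one_add_norm_sq_le_normSq {δ : ℝ} (hδ : 0 ≤ δ) {z : ℂ} (hz : z.im ≤ 0) :
    1 + δ ^ 2 * ‖z‖ ^ 2 ≤ ‖1 + Complex.I * δ * z‖ ^ 2 := by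
  rw [← Complex.normSq_eq_norm_sq, ← Complex.normSq_eq_norm_sq, Complex.normSq_apply,
    Complex.normSq_apply]
  simp
  nlinarith [mul_nonneg hδ (neg_nonneg.2 hz)]

/-- In the lower half-plane the exponential cancels the growth of F exactly. The damping factor has
its only pole at i/δ, in the upper half-plane, and its fourth power beats the linear factor with
quadratic decay to spare. -/
theorem integral_mul_exp_eq_zero {F : ℂ → ℂ} (hF : Differentiable ℂ F) {C t δ : ℝ} (hδ : 0 < δ)
    (hC : 0 ≤ C)
    (hb : ∀ z, ‖F z‖ ≤ C * (1 + ‖z‖) * Real.exp (2 * Real.pi * t * |z.im|)) :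
    Integrable (fun x : ℝ => F x * Complex.exp (-2 * Real.pi * t * x * Complex.I)
      * ((1 + Complex.I * δ * x) ^ 4)⁻¹) ∧
    ∫ x : ℝ, F x * Complex.exp (-2 * Real.pi * t * x * Complex.I)
      * ((1 + Complex.I * δ * x) ^ 4)⁻¹ = 0 := by
  have hsq : ∀ z : ℂ, z.im ≤ 0 → 1 + δ ^ 2 * ‖z‖ ^ 2 ≤ ‖1 + Complex.I * δ * z‖ ^ 2 :=
    fun z hz => one_add_norm_sq_le_normSq hδ.le hz
  have hne : ∀ z : ℂ, z.im ≤ 0 → 1 + Complex.I * δ * z ≠ 0 := fun z hz h0 => by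
    have := hsq z hz
    rw [h0] at this
    norm_num at this
    nlinarith [sq_nonneg (δ * ‖z‖)]
  set κ := min 1 (δ ^ 2) with hκ
  have hκ0 : 0 < κ := lt_min one_pos (by positivity)
  refine integral_eq_zero_of_decay_lower_half_plane (C := 2 * C / κ ^ 2) (H := fun z : ℂ => F z *
    Complex.exp (-2 * Real.pi * t * z * Complex.I) * ((1 + Complex.I * δ * z) ^ 4)⁻¹) ?_ ?_
  · intro z hz
    have h1 := hF z
    exact (h1.mul (by fun_prop)).mul (DifferentiableAt.inv (by fun_prop) (pow_ne_zero _ (hne z hz)))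
  · intro z hz
    rw [norm_mul, norm_mul, norm_inv, norm_pow, Complex.norm_exp]
    have e1 : (-2 * Real.pi * t * z * Complex.I : ℂ).re = - (2 * Real.pi * t * |z.im|) := by
      rw [abs_of_nonpos hz]; simp
    rw [e1]
    have h1 : ‖F z‖ * Real.exp (-(2 * Real.pi * t * |z.im|)) ≤ C * (1 + ‖z‖) := by
      calc _ ≤ C * (1 + ‖z‖) * Real.exp (2 * Real.pi * t * |z.im|)
            * Real.exp (-(2 * Real.pi * t * |z.im|)) := by gcongr; exact hb z
        _ = C * (1 + ‖z‖) := by rw [mul_assoc, ← Real.exp_add]; simp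
    have h2 : κ * (1 + ‖z‖ ^ 2) ≤ ‖1 + Complex.I * δ * z‖ ^ 2 := by
      refine le_trans ?_ (hsq z hz)
      have := min_le_left 1 (δ ^ 2)
      have := min_le_right 1 (δ ^ 2)
      nlinarith [sq_nonneg ‖z‖]
    have h3 : κ ^ 2 * (1 + ‖z‖ ^ 2) ^ 2 ≤ ‖1 + Complex.I * δ * z‖ ^ 4 := by
      calc _ = (κ * (1 + ‖z‖ ^ 2)) ^ 2 := by ring
        _ ≤ (‖1 + Complex.I * δ * z‖ ^ 2) ^ 2 := by gcongr
        _ = _ := by ring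
    calc _ ≤ C * (1 + ‖z‖) * (κ ^ 2 * (1 + ‖z‖ ^ 2) ^ 2)⁻¹ := by gcongr
      _ ≤ C * (2 * (1 + ‖z‖ ^ 2)) * (κ ^ 2 * (1 + ‖z‖ ^ 2) ^ 2)⁻¹ := by
          gcongr
          nlinarith [sq_nonneg (‖z‖ - 1)]
      _ = _ := by field_simp

/-- Multiplication by si carries the right half-plane to the upper (s = 1) or lower (s = -1) one.
Phragmén–Lindelöf applies to G(siw) e^{-bw}/(1 + w): dividing by 1 + w removes the linear growth on
the boundary, and b' ≤ b makes the function bounded on the positive axis. The factor 2 comes from 1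
+ |y| ≤ 2‖1 + iy‖. -/
theorem half_plane_norm_le {G : ℂ → ℂ} (hG : Differentiable ℂ G) {A b' b C : ℝ} (hA : 0 ≤ A)
    (hbb : b' ≤ b) (hC : 0 ≤ C) (hgr : ∀ z, ‖G z‖ ≤ A * Real.exp (b' * ‖z‖))
    (hre : ∀ x : ℝ, ‖G x‖ ≤ C * (1 + |x|)) {s : ℝ} (hs : |s| = 1) {ζ : ℂ} (hζ : 0 ≤ ζ.re) :
    ‖G (s * Complex.I * ζ)‖ ≤ 2 * C * (1 + ‖ζ‖) * Real.exp (b * ζ.re) := by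
  have hsn : ∀ w : ℂ, ‖s * Complex.I * w‖ = ‖w‖ := fun w => by simp [hs]
  have hone : ∀ w : ℂ, 0 ≤ w.re → 1 ≤ ‖1 + w‖ := fun w hw => by
    refine le_trans ?_ (Complex.re_le_norm _)
    simpa using hw
  have hne : ∀ w : ℂ, 0 ≤ w.re → 1 + w ≠ 0 := fun w hw h => by
    have := hone w hw
    rw [h] at this
    norm_num at this
  have hgn : ∀ w : ℂ, ‖G (s * Complex.I * w) / (1 + w) * Complex.exp (-b * w)‖
      = ‖G (s * Complex.I * w)‖ / ‖1 + w‖ * Real.exp (-b * w.re) := fun w => by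
    rw [norm_mul, norm_div, Complex.norm_exp]
    simp
  have hup : ∀ w : ℂ, 0 ≤ w.re → ‖G (s * Complex.I * w) / (1 + w) * Complex.exp (-b * w)‖
      ≤ A * Real.exp (b' * ‖w‖) * Real.exp (-b * w.re) := fun w hw => by
    rw [hgn]
    gcongr
    refine (div_le_self (norm_nonneg _) (hone w hw)).trans ?_
    simpa only [hsn] using hgr (s * Complex.I * w)
  have key := PhragmenLindelof.right_half_plane_of_bounded_on_real (C := 2 * C)
    (f := fun w => G (s * Complex.I * w) / (1 + w) * Complex.exp (-b * w)) (z := ζ) ?_ ?_ ?_ ?_ hζ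
  · rw [hgn, neg_mul, Real.exp_neg, ← div_eq_mul_inv, div_le_iff₀ (Real.exp_pos _),
      div_le_iff₀ (by linarith [hone ζ hζ])] at key
    refine key.trans ?_
    calc _ ≤ 2 * C * Real.exp (b * ζ.re) * (‖(1 : ℂ)‖ + ‖ζ‖) := by gcongr; exact norm_add_le _ _
      _ = _ := by rw [norm_one]; ring
  · refine DifferentiableOn.diffContOnCl fun w hw => ?_
    rw [Complex.closure_setOfPred_lt_re] at hw
    refine DifferentiableAt.differentiableWithinAt ?_
    have h1 : DifferentiableAt ℂ (fun w => G (s * Complex.I * w)) w :=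
      (hG _).comp w (by fun_prop)
    exact (h1.div (by fun_prop) (hne w hw)).mul (by fun_prop)
  · refine ⟨1, by norm_num, b' + |b|, Asymptotics.IsBigO.of_bound A ?_⟩
    refine Filter.eventually_inf_principal.2 (Filter.Eventually.of_forall fun w hw => ?_)
    refine (hup w (le_of_lt hw)).trans ?_
    rw [Real.norm_of_nonneg (Real.exp_pos _).le, mul_assoc, ← Real.exp_add, Real.rpow_one, add_mul]
    have h1 : -b * w.re ≤ |b| * ‖w‖ := by
      calc -b * w.re ≤ |-b * w.re| := le_abs_self _
        _ = |b| * |w.re| := by rw [abs_mul, abs_neg]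
        _ ≤ _ := by gcongr; exact Complex.abs_re_le_norm _
    exact mul_le_mul_of_nonneg_left (Real.exp_le_exp.2 (by linarith)) hA
  · refine ⟨A, Filter.eventually_map.2 ?_⟩
    filter_upwards [Filter.eventually_ge_atTop 0] with x hx
    refine (hup x (by simpa using hx)).trans ?_
    rw [mul_assoc, ← Real.exp_add, Complex.norm_real, Real.norm_of_nonneg hx, Complex.ofReal_re]
    have : b' * x + -b * x ≤ 0 := by nlinarith
    calc _ ≤ A * 1 := by gcongr; exact Real.exp_le_one_iff.2 this
      _ = A := mul_one A
  · intro y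
    rw [hgn]
    have e1 : (s * Complex.I * (y * Complex.I) : ℂ) = ((-(s * y) : ℝ) : ℂ) := by
      push_cast
      linear_combination (s * y : ℂ) * Complex.I_mul_I
    rw [e1]
    have h1 := hre (-(s * y))
    rw [abs_neg, abs_mul, hs, one_mul] at h1
    have h2 : 1 ≤ ‖1 + (y : ℂ) * Complex.I‖ := hone _ (by simp)
    have h3 : |y| ≤ ‖1 + (y : ℂ) * Complex.I‖ := by
      simpa using Complex.abs_im_le_norm (1 + (y : ℂ) * Complex.I)
    have e2 : Real.exp (-b * ((y : ℂ) * Complex.I).re) = 1 := by simp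
    rw [e2, mul_one, div_le_iff₀ (by linarith)]
    nlinarith

theorem norm_le_of_growth_of_real_bound {G : ℂ → ℂ} (hG : Differentiable ℂ G) {A b' b C : ℝ}
    (hA : 0 ≤ A) (hbb : b' ≤ b) (hC : 0 ≤ C) (hgr : ∀ z, ‖G z‖ ≤ A * Real.exp (b' * ‖z‖))
    (hre : ∀ x : ℝ, ‖G x‖ ≤ C * (1 + |x|)) (z : ℂ) :
    ‖G z‖ ≤ 2 * C * (1 + ‖z‖) * Real.exp (b * |z.im|) := by
  rcases le_total 0 z.im with h | h
  · have := half_plane_norm_le hG hA hbb hC hgr hre (s := 1) (by simp) (ζ := -Complex.I * z)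
      (by simpa using h)
    have e : ((1 : ℝ) : ℂ) * Complex.I * (-Complex.I * z) = z := by
      push_cast
      linear_combination -z * Complex.I_mul_I
    rw [e] at this
    simpa [abs_of_nonneg h] using this
  · have := half_plane_norm_le hG hA hbb hC hgr hre (s := -1) (by simp) (ζ := Complex.I * z)
      (by simpa using h)
    have e : ((-1 : ℝ) : ℂ) * Complex.I * (Complex.I * z) = z := by
      push_cast
      linear_combination -z * Complex.I_mul_I
    rw [e] at this
    simpa [abs_of_nonpos h] using this

/-- An entire function of exponential type whose restriction to the real line is square-integrable
grows at most linearly in horizontal strips. -/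
theorem norm_le_of_exponentialType_of_memLp {F : ℂ → ℂ} (hF : Differentiable ℂ F) {τ b : ℝ}
    (hτ : 0 ≤ τ) (ht : exponentialType F ≤ (τ : EReal)) (h2 : MemLp (fun x : ℝ => F x) 2)
    (hb : τ < b) :
    ∃ C, 0 ≤ C ∧ ∀ z, ‖F z‖ ≤ C * (1 + ‖z‖) * Real.exp (b * |z.im|) := by
  -- Square-integrability does not directly bound F pointwise, but it bounds the primitive G
  -- linearly on ℝ, through ‖F‖ ≤ 1 + ‖F‖². Phragmén–Lindelöf extends this to ℂ, and Cauchy's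
  -- estimate on unit circles returns to F = G'.
  obtain ⟨G, hG0, hG⟩ := hF.isExactOn_univ.with_val_at 0 0
  replace hG : ∀ z, HasDerivAt G (F z) z := fun z => hG z (Set.mem_univ _)
  have hGd : Differentiable ℂ G := fun z => (hG z).differentiableAt
  -- The midpoint leaves half of the gap b - τ to absorb the factor ‖z‖ that integration introduces.
  obtain ⟨A, hA, hgr⟩ := exists_norm_le_of_exponentialType_le hF.continuous ht
    (show τ < (τ + b) / 2 by linarith)
  have hsq : Integrable (fun x : ℝ => ‖F x‖ ^ 2) := h2.integrable_norm_pow (by norm_num)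
  set M := ∫ x : ℝ, ‖F x‖ ^ 2
  have hM : 0 ≤ M := integral_nonneg fun x => by positivity
  have hGgr : ∀ z, ‖G z‖ ≤ A * (2 / (b - τ)) * Real.exp (b * ‖z‖) := by
    intro z
    have h := (convex_closedBall (0 : ℂ) ‖z‖).norm_image_sub_le_of_norm_hasDerivWithin_le
      (f := G) (f' := F) (C := A * Real.exp ((τ + b) / 2 * ‖z‖)) (x := 0) (y := z)
      (fun w _ => (hG w).hasDerivWithinAt)
      (fun w hw => (hgr w).trans (by
        gcongr
        exacts [by linarith, by simpa using hw])) (by simp) (by simp)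
    rw [hG0, sub_zero, sub_zero] at h
    refine h.trans ?_
    have h3 : (b - τ) / 2 * ‖z‖ ≤ Real.exp ((b - τ) / 2 * ‖z‖) := by
      linarith [Real.add_one_le_exp ((b - τ) / 2 * ‖z‖)]
    have h4 : ‖z‖ ≤ 2 / (b - τ) * Real.exp ((b - τ) / 2 * ‖z‖) := by
      calc ‖z‖ = 2 / (b - τ) * ((b - τ) / 2 * ‖z‖) := by
            have : b - τ ≠ 0 := by linarith
            field_simp
        _ ≤ _ := by
            have : 0 < b - τ := by linarith
            gcongr
    calc A * Real.exp ((τ + b) / 2 * ‖z‖) * ‖z‖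
        ≤ A * Real.exp ((τ + b) / 2 * ‖z‖) * (2 / (b - τ) * Real.exp ((b - τ) / 2 * ‖z‖)) := by
          gcongr
      _ = A * (2 / (b - τ)) * (Real.exp ((τ + b) / 2 * ‖z‖) * Real.exp ((b - τ) / 2 * ‖z‖)) := by
          ring
      _ = _ := by rw [← Real.exp_add]; ring_nf
  have hGre : ∀ x : ℝ, ‖G x‖ ≤ (1 + M) * (1 + |x|) := by
    intro x
    have e : G x = ∫ y in (0 : ℝ)..x, F y := by
      rw [intervalIntegral.integral_eq_sub_of_hasDerivAt (f := fun y : ℝ => G y)]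
      · simp [hG0]
      · exact fun y _ => (hG y).comp_ofReal
      · exact (hF.continuous.comp Complex.continuous_ofReal).intervalIntegrable _ _
    have hc : Continuous fun y : ℝ => ‖F y‖ := by
      have := hF.continuous
      fun_prop
    rw [e]
    calc _ ≤ ∫ y in Set.uIoc 0 x, ‖F y‖ := intervalIntegral.norm_integral_le_integral_norm_uIoc
      _ ≤ ∫ y in Set.uIoc 0 x, (1 + ‖F y‖ ^ 2) := by
          refine setIntegral_mono ?_ ?_ fun y => ?_
          · exact intervalIntegrable_iff.1 (hc.intervalIntegrable _ _)
          · exact intervalIntegrable_iff.1 (Continuous.intervalIntegrable (by fun_prop) _ _)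
          · nlinarith [sq_nonneg (‖F y‖ - 1), norm_nonneg (F y)]
      _ = |x| + ∫ y in Set.uIoc 0 x, ‖F y‖ ^ 2 := by
          rw [integral_add (intervalIntegrable_iff.1 (continuous_const.intervalIntegrable _ _))
            hsq.integrableOn]
          simp [Measure.real, Set.uIoc, Real.volume_Ioc, max_sub_min_eq_abs]
      _ ≤ |x| + M := by
          gcongr
          exact setIntegral_le_integral hsq (Filter.Eventually.of_forall fun y => by positivity)
      _ ≤ _ := by nlinarith [abs_nonneg x]
  have hGb := norm_le_of_growth_of_real_bound hGd
    (mul_nonneg hA (div_nonneg zero_le_two (by linarith))) le_rfl (by linarith) hGgr hGre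
  have hb0 : 0 < b := by linarith
  refine ⟨4 * (1 + M) * Real.exp b, by positivity, fun z => ?_⟩
  have h := Complex.norm_deriv_le_of_forall_mem_sphere_norm_le (f := G) (c := z) (R := 1)
    (C := 2 * (1 + M) * (2 + ‖z‖) * Real.exp (b * (|z.im| + 1))) one_pos hGd.diffContOnCl ?_
  · rw [(hG z).deriv, div_one, mul_add b, Real.exp_add] at h
    refine h.trans ?_
    calc _ = 2 * (1 + M) * Real.exp b * Real.exp (b * |z.im|) * (2 + ‖z‖) := by ring_nf
      _ ≤ 2 * (1 + M) * Real.exp b * Real.exp (b * |z.im|) * (2 * (1 + ‖z‖)) := by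
          gcongr; linarith [norm_nonneg z]
      _ = _ := by ring
  · intro w hw
    have hw1 : ‖w - z‖ = 1 := by simpa [dist_eq_norm] using hw
    refine (hGb w).trans ?_
    have h3 : ‖w‖ ≤ ‖z‖ + 1 := by
      calc ‖w‖ = ‖z + (w - z)‖ := by ring_nf
        _ ≤ _ := (norm_add_le _ _).trans (by rw [hw1])
    have h4 : |w.im| ≤ |z.im| + 1 := by
      have := Complex.abs_im_le_norm (w - z)
      rw [hw1, Complex.sub_im] at this
      calc |w.im| = |z.im + (w.im - z.im)| := by ring_nf
        _ ≤ _ := (abs_add_le _ _).trans (by gcongr)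
    have h5 : 1 + ‖w‖ ≤ 2 + ‖z‖ := by linarith
    gcongr

/-! ### Vanishing of the Fourier transform outside the band -/

-- As f need not be integrable, its transform is reached only weakly. Paired with a test function
-- supported in U, each damped transform gives zero; dominated convergence removes the damping, the
-- majorant being a product of two L² functions.
open scoped FourierTransform in
theorem ae_fourier_eq_zero_of_damped {f : ℝ → ℂ} (h2 : MemLp f 2) {U : Set ℝ} (hU : IsOpen U)
    {m : ℕ → ℝ → ℂ} (hm1 : ∀ n x, ‖m n x‖ ≤ 1) (hmc : ∀ n, Continuous (m n))
    (hm : ∀ x, Filter.Tendsto (fun n => m n x) Filter.atTop (nhds 1))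
    (hint : ∀ n, Integrable fun x => f x * m n x)
    (hz : ∀ n, ∀ t ∈ U, 𝓕 (fun x => f x * m n x) t = 0) :
    ∀ᵐ t, t ∈ U → (𝓕 (h2.toLp f) : Lp ℂ 2 (volume : Measure ℝ)) t = 0 := by
  refine hU.ae_eq_zero_of_integral_contDiff_smul_eq_zero
    (((Lp.memLp _).locallyIntegrable (by norm_num)).locallyIntegrableOn _) ?_
  intro χ hχ hc hsupp
  set ψ := testSchwartz χ hχ hc
  have h := integral_schwartz_mul_fourier_Lp (h2.toLp f) ψ
  have e1 : ∫ x, 𝓕 (ψ : ℝ → ℂ) x * h2.toLp f x = ∫ x, 𝓕 (ψ : ℝ → ℂ) x * f x :=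
    integral_congr_ae (by filter_upwards [h2.coeFn_toLp] with x hx; rw [hx])
  simp only [Complex.real_smul]
  refine h.trans (e1.trans ?_)
  have hψ2 : MemLp (𝓕 (ψ : ℝ → ℂ)) 2 := by
    rw [← SchwartzMap.fourier_coe]
    exact SchwartzMap.memLp _ 2 volume
  have hlim : Filter.Tendsto (fun n => ∫ x, 𝓕 (ψ : ℝ → ℂ) x * (f x * m n x)) Filter.atTop
      (nhds (∫ x, 𝓕 (ψ : ℝ → ℂ) x * f x)) := by
    refine tendsto_integral_of_dominated_convergence (fun x => ‖𝓕 (ψ : ℝ → ℂ) x * f x‖) ?_ ?_ ?_ ?_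
    · exact fun n => hψ2.aestronglyMeasurable.mul
        (h2.aestronglyMeasurable.mul (hmc n).aestronglyMeasurable)
    · exact (hψ2.integrable_mul h2).norm
    · refine fun n => Filter.Eventually.of_forall fun x => ?_
      rw [norm_mul, norm_mul, norm_mul, ← mul_assoc]
      exact mul_le_of_le_one_right (by positivity) (hm1 n x)
    · refine Filter.Eventually.of_forall fun x => ?_
      simpa using ((hm x).const_mul (f x)).const_mul (𝓕 (ψ : ℝ → ℂ) x)
  refine tendsto_nhds_unique hlim (tendsto_const_nhds.congr fun n => ?_)
  rw [integral_fourier_mul_eq_flip (SchwartzMap.integrable _) (hint n), eq_comm]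
  refine integral_eq_zero_of_ae (Filter.Eventually.of_forall fun t => ?_)
  by_cases ht : t ∈ U
  · simp [hz n t ht]
  · have : χ t = 0 := by
      by_contra h0
      exact ht (hsupp (subset_tsupport _ h0))
    have : ψ t = 0 := by
      rw [show ψ t = (χ t : ℂ) from rfl, this]; simp
    simp [this]

theorem norm_damping_le_one (δ x : ℝ) : ‖((1 + Complex.I * δ * x : ℂ) ^ 4)⁻¹‖ ≤ 1 := by
  have h : 1 ≤ ‖(1 + Complex.I * δ * x : ℂ)‖ := by
    refine le_trans ?_ (Complex.re_le_norm _)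
    simp
  rw [norm_inv, norm_pow]
  exact inv_le_one_of_one_le₀ (one_le_pow₀ h)

theorem damping_ne_zero (δ x : ℝ) : (1 + Complex.I * δ * x : ℂ) ≠ 0 := fun h => by
  have := congrArg Complex.re h
  simp at this

theorem continuous_damping (δ : ℝ) : Continuous fun x : ℝ => ((1 + Complex.I * δ * x : ℂ) ^ 4)⁻¹ :=
  Continuous.inv₀ (by fun_prop) fun x => pow_ne_zero _ (damping_ne_zero δ x)

theorem tendsto_damping {u : ℕ → ℝ} (hu : Filter.Tendsto u Filter.atTop (nhds 0)) (x : ℝ) :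
    Filter.Tendsto (fun n => ((1 + Complex.I * u n * x : ℂ) ^ 4)⁻¹) Filter.atTop (nhds 1) := by
  have h : Continuous fun δ : ℝ => ((1 + Complex.I * δ * x : ℂ) ^ 4)⁻¹ :=
    Continuous.inv₀ (by fun_prop) fun δ => pow_ne_zero _ (damping_ne_zero δ x)
  have := (h.tendsto 0).comp hu
  simpa [Function.comp_def] using this

open scoped FourierTransform in
theorem fourier_damped_eq_zero {F : ℂ → ℂ} (hF : Differentiable ℂ F) {C t δ : ℝ} (hδ : 0 < δ)
    (hC : 0 ≤ C)
    (hb : ∀ z, ‖F z‖ ≤ C * (1 + ‖z‖) * Real.exp (2 * Real.pi * t * |z.im|)) :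
    Integrable (fun x : ℝ => F x * ((1 + Complex.I * δ * x) ^ 4)⁻¹) ∧
    𝓕 (fun x : ℝ => F x * ((1 + Complex.I * δ * x) ^ 4)⁻¹) t = 0 := by
  obtain ⟨h1, h2⟩ := integral_mul_exp_eq_zero hF hδ hC hb
  have e : ∀ x : ℝ, F x * Complex.exp (-2 * Real.pi * t * x * Complex.I)
      * ((1 + Complex.I * δ * x) ^ 4)⁻¹
      = Complex.exp (-2 * Real.pi * t * x * Complex.I) *
        (F x * ((1 + Complex.I * δ * x) ^ 4)⁻¹) := fun x => by ring
  constructor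
  · refine h1.norm.mono' ?_ (Filter.Eventually.of_forall fun x => ?_)
    · exact ((hF.continuous.comp Complex.continuous_ofReal).mul
        (continuous_damping δ)).aestronglyMeasurable
    · rw [e, norm_mul (Complex.exp _)]
      have : ‖Complex.exp (-2 * Real.pi * t * x * Complex.I)‖ = 1 := by
        rw [Complex.norm_exp]; simp
      rw [this, one_mul]
  · rw [Real.fourier_real_eq_integral_exp_smul, ← h2]
    refine integral_congr_ae (Filter.Eventually.of_forall fun x => ?_)
    simp only [e, smul_eq_mul]
    congr 2
    push_cast
    ring

-- Negative frequencies follow by the reflection z ↦ -z, which moves the pole of the damping factor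
-- to the other half-plane; hence the opposite sign of δ.
open scoped FourierTransform in
theorem fourier_damped_neg_eq_zero {F : ℂ → ℂ} (hF : Differentiable ℂ F) {C t δ : ℝ} (hδ : 0 < δ)
    (hC : 0 ≤ C)
    (hb : ∀ z, ‖F z‖ ≤ C * (1 + ‖z‖) * Real.exp (2 * Real.pi * (-t) * |z.im|)) :
    Integrable (fun x : ℝ => F x * ((1 + Complex.I * (-δ : ℝ) * x) ^ 4)⁻¹) ∧
    𝓕 (fun x : ℝ => F x * ((1 + Complex.I * (-δ : ℝ) * x) ^ 4)⁻¹) t = 0 := by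
  obtain ⟨h1, h2⟩ := fourier_damped_eq_zero (F := fun z => F (-z)) (t := -t) (by fun_prop) hδ hC
    (fun z => by simpa using hb (-z))
  have e : (fun x : ℝ => F x * ((1 + Complex.I * (-δ : ℝ) * x) ^ 4)⁻¹) = fun x : ℝ =>
      (fun y : ℝ => F (-y) * ((1 + Complex.I * δ * y) ^ 4)⁻¹) (-x) := by
    funext x
    simp
  rw [e]
  refine ⟨h1.comp_neg, ?_⟩
  rw [← Real.fourierInv_eq_fourier_comp_neg (fun y : ℝ => F (-y) * ((1 + Complex.I * δ * y) ^ 4)⁻¹),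
    Real.fourierInv_eq_fourier_neg]
  exact h2

/-! ### The Fourier–Laplace transform and the Paley–Wiener theorem -/

section

/-- The Fourier–Laplace transform `z ↦ ∫ g(t) e^{2πitz} dt`. -/
noncomputable def fourierLaplace (g : ℝ → ℂ) (z : ℂ) : ℂ :=
  ∫ t : ℝ, g t * Complex.exp (2 * Real.pi * Complex.I * t * z)

open scoped FourierTransform in
theorem fourierLaplace_ofReal (g : ℝ → ℂ) (x : ℝ) : fourierLaplace g x = 𝓕⁻ g x := by
  rw [Real.fourierInv_eq', fourierLaplace]
  refine integral_congr_ae (Filter.Eventually.of_forall fun t => ?_)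
  simp only [smul_eq_mul, RCLike.inner_apply, conj_trivial]
  rw [mul_comm]
  congr 2
  push_cast
  ring

theorem norm_exp_two_pi_I (t : ℝ) (z : ℂ) :
    ‖Complex.exp (2 * Real.pi * Complex.I * t * z)‖ = Real.exp (-(2 * Real.pi * t * z.im)) := by
  rw [Complex.norm_exp]
  congr 1
  simp

theorem norm_exp_two_pi_I_le {a t : ℝ} (ht : |t| ≤ a) (z : ℂ) :
    ‖Complex.exp (2 * Real.pi * Complex.I * t * z)‖ ≤ Real.exp (2 * Real.pi * a * |z.im|) := by
  rw [norm_exp_two_pi_I]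
  gcongr
  calc -(2 * Real.pi * t * z.im) ≤ |-(2 * Real.pi * t * z.im)| := le_abs_self _
    _ = 2 * Real.pi * |t| * |z.im| := by
        rw [abs_neg, abs_mul, abs_mul, abs_of_pos (by positivity : 0 < 2 * Real.pi)]
    _ ≤ _ := by gcongr

variable {g : ℝ → ℂ} {a : ℝ}

theorem norm_mul_exp_le (hs : ∀ t, a < |t| → g t = 0) (t : ℝ) (z : ℂ) :
    ‖g t * Complex.exp (2 * Real.pi * Complex.I * t * z)‖
      ≤ ‖g t‖ * Real.exp (2 * Real.pi * a * |z.im|) := by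
  by_cases ht : a < |t|
  · simp [hs t ht]
  · rw [norm_mul]
    gcongr
    exact norm_exp_two_pi_I_le (not_lt.1 ht) z

theorem integrable_mul_exp (hg : Integrable g) (hs : ∀ t, a < |t| → g t = 0) (z : ℂ) :
    Integrable fun t : ℝ => g t * Complex.exp (2 * Real.pi * Complex.I * t * z) := by
  refine (hg.norm.mul_const (Real.exp (2 * Real.pi * a * |z.im|))).mono' ?_
    (Filter.Eventually.of_forall fun t => norm_mul_exp_le hs t z)
  exact hg.aestronglyMeasurable.mul (Continuous.aestronglyMeasurable (by fun_prop))

theorem norm_fourierLaplace_le (hg : Integrable g) (hs : ∀ t, a < |t| → g t = 0) (z : ℂ) :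
    ‖fourierLaplace g z‖ ≤ (∫ t, ‖g t‖) * Real.exp (2 * Real.pi * a * |z.im|) := by
  rw [← integral_mul_const]
  exact norm_integral_le_of_norm_le (hg.norm.mul_const _)
    (Filter.Eventually.of_forall fun t => norm_mul_exp_le hs t z)

theorem norm_fourierLaplace_ofReal_le (g : ℝ → ℂ) (x : ℝ) :
    ‖fourierLaplace g x‖ ≤ ∫ t, ‖g t‖ := by
  refine (norm_integral_le_integral_norm _).trans_eq ?_
  congr 1
  funext t
  rw [norm_mul, norm_exp_two_pi_I]
  simp

theorem differentiable_fourierLaplace (hg : Integrable g) (hs : ∀ t, a < |t| → g t = 0) :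
    Differentiable ℂ (fourierLaplace g) := by
  intro z₀
  have hder : ∀ (t : ℝ) (z : ℂ), HasDerivAt
      (fun z => g t * Complex.exp (2 * Real.pi * Complex.I * t * z))
      (g t * Complex.exp (2 * Real.pi * Complex.I * t * z) * (2 * Real.pi * Complex.I * t)) z := by
    intro t z
    have h1 : HasDerivAt (fun z : ℂ => 2 * Real.pi * Complex.I * t * z)
        (2 * Real.pi * Complex.I * t) z := by
      simpa using (hasDerivAt_id z).const_mul (2 * Real.pi * Complex.I * t : ℂ)
    simpa [mul_assoc] using h1.cexp.const_mul (g t)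
  have h := hasDerivAt_integral_of_dominated_loc_of_deriv_le (μ := volume) (x₀ := z₀)
    (s := Metric.ball z₀ 1)
    (F := fun z t => g t * Complex.exp (2 * Real.pi * Complex.I * t * z))
    (F' := fun z t => g t * Complex.exp (2 * Real.pi * Complex.I * t * z) *
      (2 * Real.pi * Complex.I * t))
    (bound := fun t => ‖g t‖ * (Real.exp (2 * Real.pi * |a| * (|z₀.im| + 1)) * (2 * Real.pi * |a|)))
    (Metric.ball_mem_nhds z₀ one_pos)
    (Filter.Eventually.of_forall fun z => (integrable_mul_exp hg hs z).aestronglyMeasurable)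
    (integrable_mul_exp hg hs z₀)
    ((integrable_mul_exp hg hs z₀).aestronglyMeasurable.mul
      (Continuous.aestronglyMeasurable (by fun_prop)))
    (Filter.Eventually.of_forall fun t z hz => ?_)
    (hg.norm.mul_const _)
    (Filter.Eventually.of_forall fun t z _ => hder t z)
  · exact h.2.differentiableAt
  · by_cases ht : a < |t|
    · simp [hs t ht]
    · have ht' : |t| ≤ |a| := (not_lt.1 ht).trans (le_abs_self a)
      have hz' : |z.im| ≤ |z₀.im| + 1 := by
        have h1 : ‖z - z₀‖ < 1 := by simpa [dist_eq_norm] using hz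
        have h2 := Complex.abs_im_le_norm (z - z₀)
        rw [Complex.sub_im] at h2
        have h3 := abs_sub_abs_le_abs_sub z.im z₀.im
        linarith
      have h4 := norm_exp_two_pi_I_le ht' z
      have h5 : ‖(2 * Real.pi * Complex.I * t : ℂ)‖ = 2 * Real.pi * |t| := by
        simp [abs_of_pos Real.pi_pos]
      rw [norm_mul, norm_mul, h5, mul_assoc]
      gcongr
      exact h4.trans (by gcongr)

theorem exponentialType_fourierLaplace_le (hg : Integrable g) (ha : 0 ≤ a)
    (hs : ∀ t, a < |t| → g t = 0) :
    exponentialType (fourierLaplace g) ≤ ((2 * Real.pi * a : ℝ) : EReal) := by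
  refine exponentialType_le_of_norm_le (C := (∫ t, ‖g t‖) + 1)
    (by have : 0 ≤ ∫ t, ‖g t‖ := integral_nonneg fun t => norm_nonneg _
        linarith) fun z => (norm_fourierLaplace_le hg hs z).trans ?_
  gcongr
  · linarith
  · exact Complex.abs_im_le_norm z

theorem integrable_of_memLp_of_support (h2 : MemLp g 2) (hs : ∀ t, a < |t| → g t = 0) :
    Integrable g := by
  have h : Integrable (Set.indicator (Set.Icc (-a) a) g) := by
    rw [integrable_indicator_iff measurableSet_Icc]
    exact (h2.restrict _).integrable (by norm_num)
  convert! h using 1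
  funext t
  by_cases ht : t ∈ Set.Icc (-a) a
  · rw [Set.indicator_of_mem ht]
  · rw [Set.indicator_of_notMem ht, hs t]
    by_contra h
    exact ht (abs_le.1 (not_lt.1 h))

open scoped FourierTransform in
theorem memLp_fourierLaplace (hg : Integrable g) (h2 : MemLp g 2) :
    MemLp (fun x : ℝ => fourierLaplace g x) 2 := by
  simp_rw [fourierLaplace_ofReal]
  exact memLp_fourierInv hg h2

open scoped ComplexConjugate in
theorem integral_fourierLaplace_mul_conj {f g : ℝ → ℂ} (hf1 : Integrable f) (hf2 : MemLp f 2)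
    (hg1 : Integrable g) (hg2 : MemLp g 2) :
    ∫ x : ℝ, fourierLaplace f x * conj (fourierLaplace g x) = ∫ x, f x * conj (g x) := by
  simp_rw [fourierLaplace_ofReal]
  exact integral_fourierInv_mul_conj hf1 hf2 hg1 hg2

/-- Continuity upgrades the hypothesis to equality on all of ℝ, and the identity theorem applies
along 1/(n + 1) → 0. -/
theorem eq_of_ae_eq_real {F G : ℂ → ℂ} (hF : Differentiable ℂ F) (hG : Differentiable ℂ G)
    (h : (fun x : ℝ => F x) =ᵐ[volume] fun x : ℝ => G x) : F = G := by
  have h1 : (fun x : ℝ => F x) = fun x : ℝ => G x :=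
    (hF.continuous.comp Complex.continuous_ofReal).ae_eq_iff_eq volume
      (hG.continuous.comp Complex.continuous_ofReal) |>.1 h
  refine AnalyticOnNhd.eq_of_frequently_eq (z₀ := 0) (fun z _ => hF.analyticAt z)
    (fun z _ => hG.analyticAt z) ?_
  have h2 : Filter.Tendsto (fun n : ℕ => (((1 / ((n : ℝ) + 1) : ℝ)) : ℂ)) Filter.atTop
      (nhdsWithin 0 {0}ᶜ) := by
    refine tendsto_nhdsWithin_iff.2 ⟨?_, Filter.Eventually.of_forall fun n => ?_⟩
    · have := (Complex.continuous_ofReal.tendsto 0).comp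
        (tendsto_one_div_add_atTop_nhds_zero_nat (𝕜 := ℝ))
      simpa [Function.comp_def] using this
    · have : (n : ℝ) + 1 ≠ 0 := by positivity
      simp only [Set.mem_compl_iff, Set.mem_singleton_iff, Complex.ofReal_eq_zero]
      positivity
  exact h2.frequently (Filter.Frequently.of_forall fun n => congrFun h1 _)

open scoped FourierTransform in
/-- **Paley–Wiener theorem**: an entire function of exponential type at most `2πa` which is
square-integrable on the real line is the Fourier–Laplace transform of a square-integrable function
supported in `[-a, a]`. -/
theorem exists_eq_fourierLaplace {F : ℂ → ℂ} (hF : Differentiable ℂ F) (ha : 0 ≤ a)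
    (ht : exponentialType F ≤ ((2 * Real.pi * a : ℝ) : EReal))
    (h2 : MemLp (fun x : ℝ => F x) 2) :
    ∃ g : ℝ → ℂ, MemLp g 2 ∧ (∀ t, a < |t| → g t = 0) ∧ F = fourierLaplace g := by
  -- A strict inequality t > a supplies the slack needed in the growth bound, so the transform
  -- vanishes on the open set |t| > a.
  have hgrow : ∀ t, a < t → ∃ C, 0 ≤ C ∧
      ∀ z, ‖F z‖ ≤ C * (1 + ‖z‖) * Real.exp (2 * Real.pi * t * |z.im|) := fun t hat =>
    norm_le_of_exponentialType_of_memLp hF (by positivity) ht h2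
      (mul_lt_mul_of_pos_left hat (by positivity))
  have hδ : ∀ n : ℕ, (0 : ℝ) < 1 / ((n : ℝ) + 1) := fun n => by positivity
  have hδ0 := tendsto_one_div_add_atTop_nhds_zero_nat (𝕜 := ℝ)
  have hpos := ae_fourier_eq_zero_of_damped h2 (isOpen_Ioi (a := a))
    (m := fun n x => ((1 + Complex.I * (1 / ((n : ℝ) + 1) : ℝ) * x) ^ 4)⁻¹)
    (fun n x => norm_damping_le_one _ x) (fun n => continuous_damping _)
    (fun x => tendsto_damping hδ0 x)
    (fun n => by
      obtain ⟨C, hC, hb⟩ := hgrow (a + 1) (by linarith)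
      exact (fourier_damped_eq_zero hF (hδ n) hC hb).1)
    (fun n t ht => by
      obtain ⟨C, hC, hb⟩ := hgrow t ht
      exact (fourier_damped_eq_zero hF (hδ n) hC hb).2)
  have hneg := ae_fourier_eq_zero_of_damped h2 (isOpen_Iio (a := -a))
    (m := fun n x => ((1 + Complex.I * (-(1 / ((n : ℝ) + 1)) : ℝ) * x) ^ 4)⁻¹)
    (fun n x => norm_damping_le_one _ x) (fun n => continuous_damping _)
    (fun x => tendsto_damping (by simpa using hδ0.neg) x)
    (fun n => by
      obtain ⟨C, hC, hb⟩ := hgrow (a + 1) (by linarith)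
      exact (fourier_damped_neg_eq_zero (t := -(a + 1)) hF (hδ n) hC (by simpa using hb)).1)
    (fun n t ht => by
      obtain ⟨C, hC, hb⟩ := hgrow (-t) (by rw [Set.mem_Iio] at ht; linarith)
      exact (fourier_damped_neg_eq_zero hF (hδ n) hC hb).2)
  set u : Lp ℂ 2 (volume : Measure ℝ) := 𝓕 (h2.toLp (fun x : ℝ => F x)) with hu
  -- Truncation changes the L² transform only on a null set, but makes the support condition hold at
  -- every point.
  set g : ℝ → ℂ := Set.indicator {t | |t| ≤ a} u with hg
  have hms : MeasurableSet {t : ℝ | |t| ≤ a} := measurableSet_le (by fun_prop) (by fun_prop)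
  have hg2 : MemLp g 2 := (Lp.memLp u).indicator hms
  have hgs : ∀ t, a < |t| → g t = 0 := fun t ht =>
    Set.indicator_of_notMem (by simpa using ht) _
  have hg1 := integrable_of_memLp_of_support hg2 hgs
  have hgu : g =ᵐ[volume] u := by
    filter_upwards [hpos, hneg] with t h3 h4
    by_cases ht : |t| ≤ a
    · exact Set.indicator_of_mem (by simpa using ht) _
    · rw [hgs t (not_le.1 ht)]
      rcases lt_abs.1 (not_le.1 ht) with h | h
      · exact (h3 h).symm
      · exact (h4 (by rw [Set.mem_Iio]; linarith)).symm
  refine ⟨g, hg2, hgs, eq_of_ae_eq_real hF (differentiable_fourierLaplace hg1 hgs) ?_⟩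
  have h5 : hg2.toLp g = u := by
    apply Lp.ext
    exact hg2.coeFn_toLp.trans hgu
  have h6 := fourierInv_toLp_ae_eq hg1 hg2
  rw [h5, hu, FourierTransform.fourierInv_fourier_eq] at h6
  simp_rw [fourierLaplace_ofReal]
  exact h2.coeFn_toLp.symm.trans h6

end

/-! ### The weighted measures and comparison of norms -/

section

/-- The weight `1 + ε sin(2πx)/(2πx)`. -/
noncomputable def sincWeight (ε x : ℝ) : ℝ := 1 + ε * Real.sinc (2 * Real.pi * x)

/-- The measure with density `1 + ε sin(2πx)/(2πx)` and an atom of mass `m` at the origin. -/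
noncomputable def weightMeasure (ε : ℝ) (m : NNReal) : Measure ℝ :=
  volume.withDensity (fun x => ENNReal.ofReal (sincWeight ε x)) + (m : ENNReal) • Measure.dirac 0

theorem continuous_sincWeight (ε : ℝ) : Continuous (sincWeight ε) :=
  continuous_const.add (continuous_const.mul
    (Real.continuous_sinc.comp (continuous_const.mul continuous_id)))

variable {ε : ℝ} {m : NNReal}

theorem abs_mul_sinc_le (hε : |ε| ≤ 1) (y : ℝ) : |ε * Real.sinc y| ≤ |Real.sinc y| := by
  rw [abs_mul]
  exact mul_le_of_le_one_left (abs_nonneg _) hε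

theorem sincWeight_nonneg (hε : |ε| ≤ 1) (x : ℝ) : 0 ≤ sincWeight ε x := by
  have h := (abs_le.1 ((abs_mul_sinc_le hε _).trans (Real.abs_sinc_le_one (2 * Real.pi * x)))).1
  unfold sincWeight
  linarith

theorem sincWeight_le_two (hε : |ε| ≤ 1) (x : ℝ) : sincWeight ε x ≤ 2 := by
  have h := (abs_le.1 ((abs_mul_sinc_le hε _).trans (Real.abs_sinc_le_one (2 * Real.pi * x)))).2
  unfold sincWeight
  linarith

theorem abs_sinc_lt_one {y : ℝ} (hy : y ≠ 0) : |Real.sinc y| < 1 := by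
  rw [Real.sinc_of_ne_zero hy, abs_div, div_lt_one (abs_pos.2 hy)]
  exact Real.abs_sin_lt_abs hy

/-- Compactness handles δ ≤ |y| ≤ 2; beyond that |sinc y| ≤ 1/|y| < 1/2. -/
theorem exists_pos_le_one_sub_abs_sinc {δ : ℝ} (hδ : 0 < δ) :
    ∃ c, 0 < c ∧ ∀ y, δ ≤ |y| → c ≤ 1 - |Real.sinc y| := by
  have hcomp : IsCompact ({y : ℝ | δ ≤ |y|} ∩ Set.Icc (-2) 2) :=
    isCompact_Icc.inter_left (isClosed_le continuous_const continuous_abs)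
  have hcont : Continuous fun y => 1 - |Real.sinc y| :=
    continuous_const.sub Real.continuous_sinc.abs
  have hpos : ∀ y ∈ {y : ℝ | δ ≤ |y|} ∩ Set.Icc (-2) 2, 0 < 1 - |Real.sinc y| := fun y hy => by
    have : y ≠ 0 := abs_pos.1 (hδ.trans_le hy.1)
    linarith [abs_sinc_lt_one this]
  obtain ⟨c, hc, hcb⟩ := hcomp.exists_forall_le' hcont.continuousOn hpos
  refine ⟨min c (1 / 2), by positivity, fun y hy => ?_⟩
  by_cases h2 : |y| ≤ 2
  · exact (min_le_left _ _).trans (hcb y ⟨hy, abs_le.1 h2⟩)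
  · refine (min_le_right _ _).trans ?_
    have hy0 : y ≠ 0 := abs_pos.1 (hδ.trans_le hy)
    have : |Real.sinc y| ≤ 1 / 2 := by
      rw [Real.sinc_of_ne_zero hy0, abs_div, div_le_iff₀ (abs_pos.2 hy0)]
      have := Real.abs_sin_le_one y
      linarith
    linarith

theorem exists_pos_le_sincWeight (hε : |ε| ≤ 1) {δ : ℝ} (hδ : 0 < δ) :
    ∃ c, 0 < c ∧ ∀ x, δ ≤ |x| → c ≤ sincWeight ε x := by
  obtain ⟨c, hc, h⟩ := exists_pos_le_one_sub_abs_sinc (δ := 2 * Real.pi * δ) (by positivity)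
  refine ⟨c, hc, fun x hx => ?_⟩
  have h1 := h (2 * Real.pi * x) (by
    rw [abs_mul, abs_of_pos (by positivity : 0 < 2 * Real.pi)]
    gcongr)
  have h2 := neg_abs_le (ε * Real.sinc (2 * Real.pi * x))
  have h3 := abs_mul_sinc_le hε (2 * Real.pi * x)
  unfold sincWeight
  linarith

theorem integrable_dirac_smul {E : Type*} [NormedAddCommGroup E] (f : ℝ → E) :
    Integrable f ((m : ENNReal) • Measure.dirac (0 : ℝ)) := by
  refine Integrable.smul_measure ?_ ENNReal.coe_ne_top
  exact integrable_dirac (by simp)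

section

variable {E : Type*} [NormedAddCommGroup E] [NormedSpace ℝ E]

theorem integrable_withDensity_sincWeight (hε : |ε| ≤ 1) {f : ℝ → E} :
    Integrable f (volume.withDensity fun x => ENNReal.ofReal (sincWeight ε x)) ↔
      Integrable fun x => sincWeight ε x • f x := by
  rw [integrable_withDensity_iff_integrable_smul' (by
    have := continuous_sincWeight ε
    fun_prop) (Filter.Eventually.of_forall fun x => ENNReal.ofReal_lt_top)]
  simp_rw [ENNReal.toReal_ofReal (sincWeight_nonneg hε _)]

theorem integrable_weightMeasure (hε : |ε| ≤ 1) {f : ℝ → E} :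
    Integrable f (weightMeasure ε m) ↔ Integrable fun x => sincWeight ε x • f x := by
  rw [weightMeasure, integrable_add_measure, integrable_withDensity_sincWeight hε]
  exact and_iff_left (integrable_dirac_smul f)

theorem integrable_sincWeight_smul (hε : |ε| ≤ 1) {f : ℝ → E} (hf : Integrable f) :
    Integrable fun x => sincWeight ε x • f x :=
  hf.bdd_smul 2 (continuous_sincWeight ε).aestronglyMeasurable
    (Filter.Eventually.of_forall fun x => by
      rw [Real.norm_of_nonneg (sincWeight_nonneg hε x)]
      exact sincWeight_le_two hε x)

theorem integral_weightMeasure [CompleteSpace E] (hε : |ε| ≤ 1) {f : ℝ → E}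
    (hf : Integrable fun x => sincWeight ε x • f x) :
    ∫ x, f x ∂(weightMeasure ε m) = (∫ x, sincWeight ε x • f x) + (m : ℝ) • f 0 := by
  rw [weightMeasure, integral_add_measure ((integrable_withDensity_sincWeight hε).2 hf)
    (integrable_dirac_smul f), integral_smul_measure, integral_dirac,
    integral_withDensity_eq_integral_toReal_smul (by
    have := continuous_sincWeight ε
    fun_prop) (Filter.Eventually.of_forall fun x => ENNReal.ofReal_lt_top)]
  simp_rw [ENNReal.toReal_ofReal (sincWeight_nonneg hε _)]
  rfl

end

/-- The weight is at most 2, and bounded below for |x| ≥ 1; near its possible zero at the origin,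
continuity of f gives local integrability for free. The atom imposes no condition. -/
theorem memLp_weightMeasure_iff (hε : |ε| ≤ 1) {f : ℝ → ℂ} (hf : Continuous f) :
    MemLp f 2 (weightMeasure ε m) ↔ MemLp f 2 volume := by
  rw [memLp_two_iff_integrable_sq_norm hf.aestronglyMeasurable,
    memLp_two_iff_integrable_sq_norm hf.aestronglyMeasurable, integrable_weightMeasure hε]
  refine ⟨fun h => ?_, fun h => integrable_sincWeight_smul hε h⟩
  obtain ⟨c, hc, hcb⟩ := exists_pos_le_sincWeight hε one_pos
  have h1 : Integrable (fun x => c⁻¹ * (sincWeight ε x * ‖f x‖ ^ 2)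
      + Set.indicator (Set.Icc (-1) 1) (fun x => ‖f x‖ ^ 2) x) := by
    refine Integrable.add (h.const_mul _) ?_
    rw [integrable_indicator_iff measurableSet_Icc]
    exact (Continuous.continuousOn (by fun_prop)).integrableOn_Icc
  refine h1.mono' (by fun_prop) (Filter.Eventually.of_forall fun x => ?_)
  rw [Real.norm_of_nonneg (by positivity)]
  by_cases hx : x ∈ Set.Icc (-1 : ℝ) 1
  · rw [Set.indicator_of_mem hx]
    have := sincWeight_nonneg hε x
    have : 0 ≤ c⁻¹ * (sincWeight ε x * ‖f x‖ ^ 2) := by positivity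
    linarith
  · rw [Set.indicator_of_notMem hx, add_zero, ← mul_assoc]
    refine le_mul_of_one_le_left (by positivity) ?_
    rw [← div_eq_inv_mul, one_le_div hc]
    refine hcb x ?_
    by_contra! h
    exact hx (abs_le.1 h.le)

/-- Cauchy–Schwarz on [-a, a], obtained by expanding the nonnegative variance of ‖g‖. -/
theorem sq_integral_norm_le {g : ℝ → ℂ} {a : ℝ} (ha : 0 < a) (h2 : MemLp g 2)
    (hs : ∀ t, a < |t| → g t = 0) :
    (∫ t, ‖g t‖) ^ 2 ≤ 2 * a * ∫ t, ‖g t‖ ^ 2 := by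
  have h1 := integrable_of_memLp_of_support h2 hs
  have hsq : Integrable (fun t => ‖g t‖ ^ 2) := h2.integrable_norm_pow (by norm_num)
  set S := ∫ t, ‖g t‖ with hS
  have e : ∀ f : ℝ → ℝ, (∀ t, a < |t| → f t = 0) → ∫ t in Set.Icc (-a) a, f t = ∫ t, f t := by
    intro f hf
    refine setIntegral_eq_integral_of_forall_compl_eq_zero fun t ht => hf t ?_
    by_contra! h
    exact ht (abs_le.1 h)
  have h0 : 0 ≤ ∫ t in Set.Icc (-a) a, (‖g t‖ - S / (2 * a)) ^ 2 :=
    integral_nonneg fun t => sq_nonneg _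
  have h3 : ∫ t in Set.Icc (-a) a, (‖g t‖ - S / (2 * a)) ^ 2
      = (∫ t in Set.Icc (-a) a, ‖g t‖ ^ 2) - (S / a) * (∫ t in Set.Icc (-a) a, ‖g t‖)
        + ∫ t in Set.Icc (-a) a, (S / (2 * a)) ^ 2 := by
    rw [← integral_const_mul, ← integral_sub hsq.integrableOn
      (h1.norm.integrableOn.const_mul _), ← integral_add]
    · congr 1
      funext t
      field_simp
      ring
    · exact hsq.integrableOn.sub (h1.norm.integrableOn.const_mul _)
    · exact integrable_const _
  rw [h3, e _ (fun t ht => by simp [hs t ht]), e _ (fun t ht => by simp [hs t ht])] at h0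
  simp only [integral_const, MeasurableSet.univ, measureReal_restrict_apply, Set.univ_inter,
    Real.volume_real_Icc, smul_eq_mul] at h0
  rw [← hS, max_eq_left (by linarith)] at h0
  have h4 : (∫ t, ‖g t‖ ^ 2) - S / a * S + (a - -a) * (S / (2 * a)) ^ 2
      = (2 * a * (∫ t, ‖g t‖ ^ 2) - S ^ 2) / (2 * a) := by
    field_simp
    ring
  rw [h4, le_div_iff₀ (by positivity)] at h0
  linarith

theorem integral_norm_sq_fourierLaplace {g : ℝ → ℂ} (h1 : Integrable g) (h2 : MemLp g 2) :
    ∫ x : ℝ, ‖fourierLaplace g x‖ ^ 2 = ∫ t, ‖g t‖ ^ 2 := by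
  have h := integral_fourierLaplace_mul_conj h1 h2 h1 h2
  simp only [RCLike.mul_conj] at h
  have e : ∀ f : ℝ → ℂ, ∫ x, (↑(‖f x‖) : ℂ) ^ 2 = ((∫ x, ‖f x‖ ^ 2 : ℝ) : ℂ) := fun f => by
    rw [← integral_complex_ofReal]
    simp
  exact_mod_cast (e _).symm.trans (h.trans (e _))

theorem integral_norm_sq_weightMeasure_le (hε : |ε| ≤ 1) {g : ℝ → ℂ} {a : ℝ} (ha : 0 < a)
    (h2 : MemLp g 2) (hs : ∀ t, a < |t| → g t = 0) :
    ∫ x : ℝ, ‖fourierLaplace g x‖ ^ 2 ∂(weightMeasure ε m)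
      ≤ (2 + m * (2 * a)) * ∫ t, ‖g t‖ ^ 2 := by
  have h1 := integrable_of_memLp_of_support h2 hs
  have hsq : Integrable (fun x : ℝ => ‖fourierLaplace g x‖ ^ 2) :=
    (memLp_fourierLaplace h1 h2).integrable_norm_pow (by norm_num)
  rw [integral_weightMeasure hε (integrable_sincWeight_smul hε hsq), add_mul,
    ← integral_norm_sq_fourierLaplace h1 h2, ← integral_const_mul]
  have h0 : ‖fourierLaplace g ((0 : ℝ) : ℂ)‖ ^ 2 ≤ 2 * a * ∫ t, ‖g t‖ ^ 2 := by
    refine le_trans ?_ (sq_integral_norm_le ha h2 hs)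
    gcongr
    exact norm_fourierLaplace_ofReal_le g 0
  rw [← integral_norm_sq_fourierLaplace h1 h2] at h0
  gcongr
  · exact integrable_sincWeight_smul hε hsq
  · exact hsq.const_mul 2
  · intro x
    exact mul_le_mul_of_nonneg_right (sincWeight_le_two hε x) (by positivity)
  · rw [smul_eq_mul, mul_assoc]
    gcongr

/-- With N = ∫ |F|², band-limitation gives |F(x)|² ≤ 2aN at every x, so a short interval around the
origin carries at most half of N. The other half lies where the weight is bounded below. -/
theorem exists_le_integral_norm_sq_weightMeasure (hε : |ε| ≤ 1) (m : NNReal) {a : ℝ}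
    (ha : 0 < a) :
    ∃ c, 0 < c ∧ ∀ g : ℝ → ℂ, MemLp g 2 → (∀ t, a < |t| → g t = 0) →
      c * ∫ t, ‖g t‖ ^ 2 ≤ ∫ x : ℝ, ‖fourierLaplace g x‖ ^ 2 ∂(weightMeasure ε m) := by
  -- The interval |x| ≤ 1/(8a) has length 1/(4a), hence mass at most 2aN/(4a) = N/2.
  obtain ⟨c, hc, hcb⟩ := exists_pos_le_sincWeight hε (δ := 1 / (8 * a)) (by positivity)
  refine ⟨c / 2, by positivity, fun g h2 hs => ?_⟩
  have h1 := integrable_of_memLp_of_support h2 hs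
  have hsq : Integrable (fun x : ℝ => ‖fourierLaplace g x‖ ^ 2) :=
    (memLp_fourierLaplace h1 h2).integrable_norm_pow (by norm_num)
  rw [integral_weightMeasure hε (integrable_sincWeight_smul hε hsq),
    ← integral_norm_sq_fourierLaplace h1 h2]
  set N := ∫ x : ℝ, ‖fourierLaplace g x‖ ^ 2 with hN
  have hpt : ∀ x : ℝ, ‖fourierLaplace g x‖ ^ 2 ≤ 2 * a * N := fun x => by
    rw [hN, integral_norm_sq_fourierLaplace h1 h2]
    refine le_trans ?_ (sq_integral_norm_le ha h2 hs)
    gcongr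
    exact norm_fourierLaplace_ofReal_le g x
  have hloc : ∫ x in Set.Icc (-(1 / (8 * a))) (1 / (8 * a)), ‖fourierLaplace g x‖ ^ 2 ≤ N / 2 := by
    calc _ ≤ ∫ x in Set.Icc (-(1 / (8 * a))) (1 / (8 * a)), 2 * a * N :=
          setIntegral_mono hsq.integrableOn (integrable_const _) hpt
      _ = N / 2 := by
          have : 0 < 1 / (8 * a) := by positivity
          simp only [integral_const, MeasurableSet.univ, measureReal_restrict_apply,
            Set.univ_inter, Real.volume_real_Icc, smul_eq_mul]
          rw [max_eq_left (by linarith)]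
          field_simp
          ring
  have hlow : c * (N - N / 2) ≤ ∫ x, sincWeight ε x • ‖fourierLaplace g x‖ ^ 2 := by
    calc c * (N - N / 2)
        ≤ c * (N - ∫ x in Set.Icc (-(1 / (8 * a))) (1 / (8 * a)), ‖fourierLaplace g x‖ ^ 2) := by
          gcongr
      _ = ∫ x : ℝ, c * (‖fourierLaplace g x‖ ^ 2 - Set.indicator
            (Set.Icc (-(1 / (8 * a))) (1 / (8 * a))) (fun x : ℝ => ‖fourierLaplace g x‖ ^ 2) x) := by
          rw [integral_const_mul, integral_sub hsq (hsq.indicator measurableSet_Icc),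
            integral_indicator measurableSet_Icc]
      _ ≤ _ := by
          refine integral_mono ((hsq.sub (hsq.indicator measurableSet_Icc)).const_mul c)
            (integrable_sincWeight_smul hε hsq) fun x => ?_
          by_cases hx : x ∈ Set.Icc (-(1 / (8 * a))) (1 / (8 * a))
          · simp only [Set.indicator_of_mem hx, sub_self, mul_zero, smul_eq_mul]
            exact mul_nonneg (sincWeight_nonneg hε x) (by positivity)
          · simp only [Set.indicator_of_notMem hx, sub_zero, smul_eq_mul]
            gcongr
            refine hcb x ?_
            by_contra! h
            exact hx (abs_le.1 h.le)
  have : 0 ≤ (m : ℝ) • ‖fourierLaplace g ((0 : ℝ) : ℂ)‖ ^ 2 := by positivity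
  linarith

theorem memLp_weightMeasure_fourierLaplace (hε : |ε| ≤ 1) (m : NNReal) {g : ℝ → ℂ} {a : ℝ}
    (h2 : MemLp g 2) (hs : ∀ t, a < |t| → g t = 0) :
    MemLp (fun x : ℝ => fourierLaplace g x) 2 (weightMeasure ε m) := by
  have h1 := integrable_of_memLp_of_support h2 hs
  exact (memLp_weightMeasure_iff hε ((differentiable_fourierLaplace h1 hs).continuous.comp
    Complex.continuous_ofReal)).2 (memLp_fourierLaplace h1 h2)

/-- The spaces `H_{G, πΔ}` all coincide with the Paley–Wiener space. -/
theorem memHilbert_iff {G : SymmetryGroup} (hG : densityMeasure G = weightMeasure ε m)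
    (hε : |ε| ≤ 1) {a : ℝ} (ha : 0 ≤ a) {F : ℂ → ℂ} :
    MemHilbert G (2 * a) F ↔
      ∃ g : ℝ → ℂ, MemLp g 2 ∧ (∀ t, a < |t| → g t = 0) ∧ F = fourierLaplace g := by
  have e : Real.pi * (2 * a) = 2 * Real.pi * a := by ring
  rw [MemHilbert, hG, e]
  constructor
  · rintro ⟨hF, ht, h2⟩
    exact exists_eq_fourierLaplace hF ha ht ((memLp_weightMeasure_iff hε
      (hF.continuous.comp Complex.continuous_ofReal)).1 h2)
  · rintro ⟨g, h2, hs, rfl⟩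
    have h1 := integrable_of_memLp_of_support h2 hs
    exact ⟨differentiable_fourierLaplace h1 hs, exponentialType_fourierLaplace_le h1 ha hs,
      memLp_weightMeasure_fourierLaplace hε m h2 hs⟩

end

/-! ### Existence and uniqueness of the reproducing kernel -/

section

theorem norm_sq_L2_eq_integral {μ : Measure ℝ} (u : Lp ℂ 2 μ) : ‖u‖ ^ 2 = ∫ x, ‖u x‖ ^ 2 ∂μ := by
  have h : ((‖u‖ ^ 2 : ℝ) : ℂ) = ((∫ x, ‖u x‖ ^ 2 ∂μ : ℝ) : ℂ) := by
    rw [← integral_complex_ofReal]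
    have := inner_self_eq_norm_sq_to_K (𝕜 := ℂ) u
    rw [L2.inner_def] at this
    simp only [inner_self_eq_norm_sq_to_K] at this
    push_cast
    exact this.symm
  exact_mod_cast h

/-- Extension by zero of a square-integrable function on `[-a, a]`. -/
noncomputable def bandExtend (a : ℝ) (u : Lp ℂ 2 (volume.restrict (Set.Icc (-a) a))) : ℝ → ℂ :=
  Set.indicator (Set.Icc (-a) a) u

theorem memLp_bandExtend (a : ℝ) (u : Lp ℂ 2 (volume.restrict (Set.Icc (-a) a))) :
    MemLp (bandExtend a u) 2 :=
  (memLp_indicator_iff_restrict measurableSet_Icc).2 (Lp.memLp u)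

theorem bandExtend_eq_zero {a : ℝ} (u : Lp ℂ 2 (volume.restrict (Set.Icc (-a) a))) (t : ℝ)
    (ht : a < |t|) : bandExtend a u t = 0 :=
  Set.indicator_of_notMem (fun h : t ∈ Set.Icc (-a) a => not_le.2 ht (abs_le.2 h)) _

theorem integrable_bandExtend (a : ℝ) (u : Lp ℂ 2 (volume.restrict (Set.Icc (-a) a))) :
    Integrable (bandExtend a u) :=
  integrable_of_memLp_of_support (memLp_bandExtend a u) (bandExtend_eq_zero u)

theorem ae_restrict_to_indicator {a : ℝ} {f g : ℝ → ℂ}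
    (h : f =ᵐ[volume.restrict (Set.Icc (-a) a)] g) :
    Set.indicator (Set.Icc (-a) a) f =ᵐ[volume] Set.indicator (Set.Icc (-a) a) g := by
  rw [Filter.EventuallyEq, ae_restrict_iff' measurableSet_Icc] at h
  filter_upwards [h] with t ht
  by_cases hm : t ∈ Set.Icc (-a) a
  · rw [Set.indicator_of_mem hm, Set.indicator_of_mem hm, ht hm]
  · rw [Set.indicator_of_notMem hm, Set.indicator_of_notMem hm]

theorem fourierLaplace_congr_ae {f g : ℝ → ℂ} (h : f =ᵐ[volume] g) :
    fourierLaplace f = fourierLaplace g := by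
  funext z
  refine integral_congr_ae ?_
  filter_upwards [h] with t ht
  rw [ht]

theorem fourierLaplace_bandExtend_add (a : ℝ) (u v : Lp ℂ 2 (volume.restrict (Set.Icc (-a) a)))
    (z : ℂ) : fourierLaplace (bandExtend a (u + v)) z
      = fourierLaplace (bandExtend a u) z + fourierLaplace (bandExtend a v) z := by
  have h : bandExtend a (u + v) =ᵐ[volume] fun t => bandExtend a u t + bandExtend a v t := by
    refine (ae_restrict_to_indicator (Lp.coeFn_add u v)).trans ?_
    rw [Set.indicator_add']
    rfl
  rw [fourierLaplace_congr_ae h, fourierLaplace, fourierLaplace, fourierLaplace,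
    ← integral_add (integrable_mul_exp (integrable_bandExtend a u) (bandExtend_eq_zero u) z)
      (integrable_mul_exp (integrable_bandExtend a v) (bandExtend_eq_zero v) z)]
  simp_rw [add_mul]

theorem fourierLaplace_bandExtend_smul (a : ℝ) (c : ℂ)
    (u : Lp ℂ 2 (volume.restrict (Set.Icc (-a) a))) (z : ℂ) :
    fourierLaplace (bandExtend a (c • u)) z = c * fourierLaplace (bandExtend a u) z := by
  have h : bandExtend a (c • u) =ᵐ[volume] fun t => c * bandExtend a u t := by
    refine (ae_restrict_to_indicator (Lp.coeFn_smul c u)).trans ?_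
    refine Filter.EventuallyEq.of_eq ((Set.indicator_const_smul _ c (u : ℝ → ℂ)).trans ?_)
    rfl
  rw [fourierLaplace_congr_ae h, fourierLaplace, fourierLaplace, ← integral_const_mul]
  simp_rw [mul_assoc]

theorem integral_norm_sq_bandExtend (a : ℝ) (u : Lp ℂ 2 (volume.restrict (Set.Icc (-a) a))) :
    ∫ t, ‖bandExtend a u t‖ ^ 2 = ‖u‖ ^ 2 := by
  rw [norm_sq_L2_eq_integral, ← integral_indicator measurableSet_Icc]
  congr 1
  funext t
  by_cases hm : t ∈ Set.Icc (-a) a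
  · simp [bandExtend, hm]
  · simp [bandExtend, hm]

theorem norm_toLp_sq {μ : Measure ℝ} {f : ℝ → ℂ} (h : MemLp f 2 μ) :
    ‖h.toLp f‖ ^ 2 = ∫ x, ‖f x‖ ^ 2 ∂μ := by
  rw [norm_sq_L2_eq_integral]
  refine integral_congr_ae ?_
  filter_upwards [h.coeFn_toLp] with x hx
  rw [hx]

variable {ε : ℝ} {m : NNReal}

theorem memLp_weightMeasure_bandExtend (hε : |ε| ≤ 1) (m : NNReal) {a : ℝ}
    (u : Lp ℂ 2 (volume.restrict (Set.Icc (-a) a))) :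
    MemLp (fun x : ℝ => fourierLaplace (bandExtend a u) x) 2 (weightMeasure ε m) :=
  memLp_weightMeasure_fourierLaplace hε m (memLp_bandExtend a u) (bandExtend_eq_zero u)

/-- The Fourier–Laplace transform as a bounded operator from `L²[-a, a]` to the weighted `L²`. -/
noncomputable def fourierLaplaceCLM (hε : |ε| ≤ 1) (m : NNReal) {a : ℝ} (ha : 0 < a) :
    Lp ℂ 2 (volume.restrict (Set.Icc (-a) a)) →L[ℂ] Lp ℂ 2 (weightMeasure ε m) :=
  LinearMap.mkContinuous
    { toFun := fun u => (memLp_weightMeasure_bandExtend hε m u).toLp _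
      map_add' := fun u v => by
        rw [← MemLp.toLp_add]
        congr 1
        funext x
        exact fourierLaplace_bandExtend_add a u v x
      map_smul' := fun c u => by
        rw [RingHom.id_apply, ← MemLp.toLp_const_smul]
        congr 1
        funext x
        exact fourierLaplace_bandExtend_smul a c u x }
    (Real.sqrt (2 + m * (2 * a))) fun u => by
      refine abs_le_of_sq_le_sq' ?_ (by positivity) |>.2
      rw [mul_pow, Real.sq_sqrt (by positivity), ← integral_norm_sq_bandExtend]
      exact (norm_toLp_sq (memLp_weightMeasure_bandExtend hε m u)).trans_le (integral_norm_sq_weightMeasure_le hε ha (memLp_bandExtend a u)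
        (bandExtend_eq_zero u))

theorem coeFn_fourierLaplaceCLM (hε : |ε| ≤ 1) (m : NNReal) {a : ℝ} (ha : 0 < a)
    (u : Lp ℂ 2 (volume.restrict (Set.Icc (-a) a))) :
    (fourierLaplaceCLM hε m ha u : ℝ → ℂ) =ᵐ[weightMeasure ε m]
      fun x : ℝ => fourierLaplace (bandExtend a u) x :=
  MemLp.coeFn_toLp (memLp_weightMeasure_bandExtend hε m u)

theorem norm_fourierLaplaceCLM_sq (hε : |ε| ≤ 1) (m : NNReal) {a : ℝ} (ha : 0 < a)
    (u : Lp ℂ 2 (volume.restrict (Set.Icc (-a) a))) :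
    ‖fourierLaplaceCLM hε m ha u‖ ^ 2
      = ∫ x : ℝ, ‖fourierLaplace (bandExtend a u) x‖ ^ 2 ∂(weightMeasure ε m) :=
  norm_toLp_sq (memLp_weightMeasure_bandExtend hε m u)

theorem exists_antilipschitz_fourierLaplaceCLM (hε : |ε| ≤ 1) (m : NNReal) {a : ℝ} (ha : 0 < a) :
    ∃ K, AntilipschitzWith K (fourierLaplaceCLM hε m ha) := by
  obtain ⟨c, hc, hcb⟩ := exists_le_integral_norm_sq_weightMeasure hε m ha
  refine ⟨Real.toNNReal (Real.sqrt c)⁻¹, ContinuousLinearMap.antilipschitz_of_bound _ fun u => ?_⟩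
  have h := hcb _ (memLp_bandExtend a u) (bandExtend_eq_zero u)
  rw [integral_norm_sq_bandExtend, ← norm_fourierLaplaceCLM_sq hε m ha u] at h
  rw [Real.coe_toNNReal _ (by positivity)]
  refine abs_le_of_sq_le_sq' ?_ (by positivity) |>.2
  rw [mul_pow, inv_pow, Real.sq_sqrt hc.le, ← div_eq_inv_mul, le_div_iff₀ hc]
  linarith

/-- Evaluation at `w` as a bounded functional on `L²[-a, a]`. -/
noncomputable def evalCLM {a : ℝ} (ha : 0 < a) (w : ℂ) :
    Lp ℂ 2 (volume.restrict (Set.Icc (-a) a)) →L[ℂ] ℂ :=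
  LinearMap.mkContinuous
    { toFun := fun u => fourierLaplace (bandExtend a u) w
      map_add' := fun u v => fourierLaplace_bandExtend_add a u v w
      map_smul' := fun c u => fourierLaplace_bandExtend_smul a c u w }
    (Real.sqrt (2 * a) * Real.exp (2 * Real.pi * a * |w.im|)) fun u => by
      refine (norm_fourierLaplace_le (integrable_bandExtend a u) (bandExtend_eq_zero u) w).trans ?_
      rw [mul_right_comm (Real.sqrt _)]
      gcongr
      refine abs_le_of_sq_le_sq' ?_ (by positivity) |>.2
      rw [mul_pow, Real.sq_sqrt (by positivity), ← integral_norm_sq_bandExtend]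
      exact sq_integral_norm_le ha (memLp_bandExtend a u) (bandExtend_eq_zero u)

-- The lower norm bound makes the transform an isomorphism onto a closed, hence complete, subspace
-- of the weighted L². Riesz represents evaluation at w there, and the representing vector is pulled
-- back to the band.
open scoped ComplexConjugate in
theorem exists_kernel_function (hε : |ε| ≤ 1) (m : NNReal) {a : ℝ} (ha : 0 < a) (w : ℂ) :
    ∃ k : ℝ → ℂ, MemLp k 2 ∧ (∀ t, a < |t| → k t = 0) ∧
      ∀ g : ℝ → ℂ, MemLp g 2 → (∀ t, a < |t| → g t = 0) → fourierLaplace g w =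
        ∫ x : ℝ, fourierLaplace g x * conj (fourierLaplace k x) ∂(weightMeasure ε m) := by
  obtain ⟨K, hK⟩ := exists_antilipschitz_fourierLaplaceCLM hε m ha
  set T := fourierLaplaceCLM hε m ha with hT
  have hclosed : IsClosed (Set.range T) := hK.isClosed_range T.uniformContinuous
  let e := T.equivRange hK.injective hclosed
  have : CompleteSpace T.range := hclosed.completeSpace_coe
  obtain ⟨v, hv⟩ : ∃ v : T.range, ∀ u, inner ℂ v (e u) = evalCLM ha w u :=
    ⟨(InnerProductSpace.toDual ℂ T.range).symm ((evalCLM ha w).comp e.symm.toContinuousLinearMap),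
      fun u => by
        rw [InnerProductSpace.toDual_symm_apply]
        simp⟩
  set k := e.symm v with hk
  refine ⟨bandExtend a k, memLp_bandExtend a k, bandExtend_eq_zero k, fun g h2 hs => ?_⟩
  have hg2 : MemLp g 2 (volume.restrict (Set.Icc (-a) a)) := h2.restrict _
  set u := hg2.toLp g
  have hu : bandExtend a u =ᵐ[volume] g := by
    refine (ae_restrict_to_indicator hg2.coeFn_toLp).trans (Filter.EventuallyEq.of_eq ?_)
    refine Set.indicator_eq_self.2 fun t ht => ?_
    by_contra h
    refine ht (hs t ?_)
    by_contra! h'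
    exact h (abs_le.1 h')
  have h := hv u
  have hev : v = e k := (e.apply_symm_apply v).symm
  rw [hev, Submodule.coe_inner] at h
  have hc : ∀ u, ((e u : T.range) : Lp ℂ 2 (weightMeasure ε m)) = T u := fun u => rfl
  rw [hc, hc, L2.inner_def] at h
  have h3 : evalCLM ha w u = fourierLaplace (bandExtend a u) w := rfl
  rw [h3, fourierLaplace_congr_ae hu] at h
  rw [← h]
  refine integral_congr_ae ?_
  filter_upwards [coeFn_fourierLaplaceCLM hε m ha k, coeFn_fourierLaplaceCLM hε m ha u] with x h4 h5
  rw [h4, h5, RCLike.inner_apply, fourierLaplace_congr_ae hu]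

theorem exists_isReproducingKernel {G : SymmetryGroup}
    (hG : densityMeasure G = weightMeasure ε m) (hε : |ε| ≤ 1) {a : ℝ} (ha : 0 < a) :
    ∃ K, IsReproducingKernel G (2 * a) K := by
  choose k hk2 hks hk using exists_kernel_function hε m ha
  refine ⟨fun w => fourierLaplace (k w), fun w => ⟨?_, fun F hF => ?_⟩⟩
  · exact (memHilbert_iff hG hε ha.le).2 ⟨k w, hk2 w, hks w, rfl⟩
  · obtain ⟨g, h2, hs, rfl⟩ := (memHilbert_iff hG hε ha.le).1 hF
    rw [hG]
    exact hk w g h2 hs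

-- Apply the property of k to K z, and that of K at z to k. Only a representer k at the single point
-- w is required, so one explicit candidate at 0 determines the kernel value there.
open scoped ComplexConjugate in
theorem IsReproducingKernel.conj_symm {G : SymmetryGroup} {Δ : ℝ} {K : ℂ → ℂ → ℂ}
    (hK : IsReproducingKernel G Δ K) {w : ℂ} {k : ℂ → ℂ} (hk : MemHilbert G Δ k)
    (hrep : ∀ F, MemHilbert G Δ F → F w = ∫ x : ℝ, F x * conj (k x) ∂(densityMeasure G)) (z : ℂ) :
    K z w = conj (k z) := by
  rw [hrep (K z) (hK z).1, (hK z).2 k hk, ← integral_conj]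
  simp [mul_comm]

theorem IsReproducingKernel.unique {G : SymmetryGroup} {Δ : ℝ} {K L : ℂ → ℂ → ℂ}
    (hK : IsReproducingKernel G Δ K) (hL : IsReproducingKernel G Δ L) : K = L := by
  funext w z
  have h1 := hK.conj_symm (hL z).1 (hL z).2 w
  have h2 := hL.conj_symm (hL z).1 (hL z).2 w
  exact h1.trans h2.symm

theorem densityMeasure_U : densityMeasure .U = weightMeasure 0 0 := by
  simp [densityMeasure, weightMeasure, sincWeight]

theorem densityMeasure_O : densityMeasure .O = weightMeasure 0 (1 / 2) := by
  simp [densityMeasure, weightMeasure, sincWeight]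

theorem densityMeasure_Sp : densityMeasure .Sp = weightMeasure (-1) 0 := by
  simp [densityMeasure, weightMeasure, sincWeight, sub_eq_add_neg]

theorem densityMeasure_SOeven : densityMeasure .SOeven = weightMeasure 1 0 := by
  simp [densityMeasure, weightMeasure, sincWeight]

theorem densityMeasure_SOodd : densityMeasure .SOodd = weightMeasure (-1) 1 := by
  simp [densityMeasure, weightMeasure, sincWeight, sub_eq_add_neg]

theorem exists_densityMeasure_eq_weightMeasure (G : SymmetryGroup) :
    ∃ (ε : ℝ) (m : NNReal), |ε| ≤ 1 ∧ densityMeasure G = weightMeasure ε m := by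
  cases G with
  | U => exact ⟨0, 0, by simp, densityMeasure_U⟩
  | Sp => exact ⟨-1, 0, by simp, densityMeasure_Sp⟩
  | O => exact ⟨0, 1 / 2, by simp, densityMeasure_O⟩
  | SOeven => exact ⟨1, 0, by simp, densityMeasure_SOeven⟩
  | SOodd => exact ⟨-1, 1, by simp, densityMeasure_SOodd⟩

theorem existsUnique_isReproducingKernel (G : SymmetryGroup) {Δ : ℝ} (hΔ : 0 < Δ) :
    ∃! K : ℂ → ℂ → ℂ, IsReproducingKernel G Δ K := by
  obtain ⟨ε, m, hε, hG⟩ := exists_densityMeasure_eq_weightMeasure G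
  obtain ⟨K, hK⟩ := exists_isReproducingKernel hG hε (half_pos hΔ)
  rw [mul_div_cancel₀ _ two_ne_zero] at hK
  exact ⟨K, hK, fun L hL => hL.unique hK⟩

theorem isReproducingKernel_reproducingKernel (G : SymmetryGroup) {Δ : ℝ} (hΔ : 0 < Δ) :
    IsReproducingKernel G Δ (reproducingKernel G Δ) := by
  have h := (existsUnique_isReproducingKernel G hΔ).exists
  rw [reproducingKernel, dif_pos h]
  exact h.choose_spec

end

/-! ### The integral equation behind the value at the origin -/

section

theorem memLp_two_of_bounded {f : ℝ → ℂ} (hf : Integrable f) {B : ℝ} (hB : ∀ t, ‖f t‖ ≤ B) :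
    MemLp f 2 := by
  rw [memLp_two_iff_integrable_sq_norm hf.aestronglyMeasurable]
  refine (hf.norm.const_mul B).mono' (hf.aestronglyMeasurable.norm.pow 2)
    (Filter.Eventually.of_forall fun t => ?_)
  rw [Real.norm_of_nonneg (by positivity), sq]
  exact mul_le_mul_of_nonneg_right (hB t) (norm_nonneg _)

/-- The average of `f` over `[t - 1, t + 1]`. -/
noncomputable def windowAverage (f : ℝ → ℂ) (t : ℝ) : ℂ :=
  (1 / 2 : ℂ) * ∫ s in (t - 1)..(t + 1), f s

open scoped Convolution in
theorem windowAverage_eq_convolution (f : ℝ → ℂ) :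
    windowAverage f = (Set.indicator (Set.Ioc (-1 : ℝ) 1) fun _ => (1 / 2 : ℂ))
      ⋆[ContinuousLinearMap.mul ℂ ℂ] f := by
  funext t
  rw [convolution_def, windowAverage]
  have h : ∀ s, (ContinuousLinearMap.mul ℂ ℂ)
      ((Set.indicator (Set.Ioc (-1 : ℝ) 1) fun _ => (1 / 2 : ℂ)) s) (f (t - s)) =
      Set.indicator (Set.Ioc (-1 : ℝ) 1) (fun s => (1 / 2 : ℂ) * f (t - s)) s := fun s => by
    by_cases hs : s ∈ Set.Ioc (-1 : ℝ) 1
    · simp [hs]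
    · simp [hs]
  simp_rw [h]
  rw [integral_indicator measurableSet_Ioc, ← intervalIntegral.integral_of_le (by norm_num),
    intervalIntegral.integral_const_mul, intervalIntegral.integral_comp_sub_left (f := f)]
  simp

theorem integrable_indicator_Ioc_const (a b : ℝ) (c : ℂ) :
    Integrable (Set.indicator (Set.Ioc a b) fun _ => c) :=
  (integrable_indicator_iff measurableSet_Ioc).2 (integrable_const c)

theorem integrable_windowAverage {f : ℝ → ℂ} (hf : Integrable f) :
    Integrable (windowAverage f) := by
  rw [windowAverage_eq_convolution]
  exact Integrable.integrable_convolution _ (integrable_indicator_Ioc_const _ _ _) hf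

theorem norm_windowAverage_le {f : ℝ → ℂ} (hf : Integrable f) (t : ℝ) :
    ‖windowAverage f t‖ ≤ ∫ s, ‖f s‖ := by
  rw [windowAverage, intervalIntegral.integral_of_le (by linarith), norm_mul]
  calc _ ≤ 1 * ∫ s in Set.Ioc (t - 1) (t + 1), ‖f s‖ := by
        gcongr
        · norm_num
        · exact norm_integral_le_integral_norm _
    _ ≤ ∫ s, ‖f s‖ := by
        rw [one_mul]
        exact setIntegral_le_integral hf.norm (Filter.Eventually.of_forall fun s => norm_nonneg _)

-- Half the indicator of (-1, 1] has transform sinc(2πx), so this is the convolution theorem.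
open scoped FourierTransform Convolution in
theorem fourierLaplace_windowAverage {f : ℝ → ℂ} (hf : Integrable f) (x : ℝ) :
    fourierLaplace (windowAverage f) x = Real.sinc (2 * Real.pi * x) * fourierLaplace f x := by
  have hbox : 𝓕 (Set.indicator (Set.Ioc (-1 : ℝ) 1) fun _ => (1 / 2 : ℂ)) (-x)
      = Real.sinc (2 * Real.pi * x) := by
    rw [Real.fourier_real_eq_integral_exp_smul]
    have h : ∀ s : ℝ, Complex.exp (((-2 * Real.pi * s * -x : ℝ) : ℂ) * Complex.I) •
        (Set.indicator (Set.Ioc (-1 : ℝ) 1) fun _ => (1 / 2 : ℂ)) s =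
        Set.indicator (Set.Ioc (-1 : ℝ) 1) (fun s : ℝ => (1 / 2 : ℂ) *
          Complex.exp (((2 * Real.pi * x * s : ℝ) : ℂ) * Complex.I)) s := fun s => by
      by_cases hs : s ∈ Set.Ioc (-1 : ℝ) 1
      · simp only [Set.indicator_of_mem hs, smul_eq_mul]
        rw [mul_comm]
        congr 4
        ring
      · simp [hs]
    simp_rw [h]
    rw [integral_indicator measurableSet_Ioc, ← intervalIntegral.integral_of_le (by norm_num),
      intervalIntegral.integral_const_mul]
    by_cases hx : x = 0
    · simp [hx]
      norm_num
    · have hc : 2 * Real.pi * x ≠ 0 := by positivity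
      rw [intervalIntegral.integral_comp_mul_left
        (f := fun u : ℝ => Complex.exp ((u : ℂ) * Complex.I)) hc]
      rw [mul_neg, mul_one, integral_exp_mul_I_eq_sinc]
      have : ((2 * Real.pi * x : ℝ) : ℂ) ≠ 0 := by exact_mod_cast hc
      rw [Complex.real_smul, Complex.ofReal_inv]
      field_simp
  rw [fourierLaplace_ofReal, fourierLaplace_ofReal, Real.fourierInv_eq_fourier_neg,
    Real.fourierInv_eq_fourier_neg, windowAverage_eq_convolution,
    Real.fourier_mul_convolution_eq (integrable_indicator_Ioc_const _ _ _) hf, hbox]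

theorem fourierLaplace_zero (g : ℝ → ℂ) : fourierLaplace g 0 = ∫ t, g t := by
  simp [fourierLaplace]

variable {ε : ℝ} {m : NNReal}

open scoped ComplexConjugate in
/-- If `φ + (ε/2) 1_{[-1,1]} ⋆ φ = 1` on `[-a, a]`, then a multiple of the Fourier transform of `φ`
reproduces the value at the origin. -/
theorem reproducingKernel_zero_zero {G : SymmetryGroup}
    (hG : densityMeasure G = weightMeasure ε m) (hε : |ε| ≤ 1) {a : ℝ} (ha : 0 < a) {φ : ℝ → ℝ}
    (hφ : Integrable φ) {B : ℝ} (hB : ∀ t, |φ t| ≤ B) (hs : ∀ t, a < |t| → φ t = 0)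
    (heq : ∀ t, |t| ≤ a → φ t + ε / 2 * ∫ s in (t - 1)..(t + 1), φ s = 1)
    {k : ℝ} (hk : ∫ t, φ t = k) (hk0 : 0 ≤ k) :
    reproducingKernel G (2 * a) 0 0 = ((k / (1 + m * k) : ℝ) : ℂ) := by
  -- Pairing F with the transform of cφ gives cF(0) from the density and m·ck·F(0) from the atom;
  -- the sum is F(0) exactly for this c.
  set c : ℝ := (1 + m * k)⁻¹ with hc
  have hc1 : c * (1 + m * k) = 1 := inv_mul_cancel₀ (by positivity)
  set f : ℝ → ℂ := fun t => ((c * φ t : ℝ) : ℂ) with hf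
  have hf1 : Integrable f := (hφ.const_mul c).ofReal
  have hf2 : MemLp f 2 := memLp_two_of_bounded hf1 (B := |c| * B) fun t => by
    rw [hf, Complex.norm_real, Real.norm_eq_abs, abs_mul]
    gcongr
    exact hB t
  have hfs : ∀ t, a < |t| → f t = 0 := fun t ht => by simp [hf, hs t ht]
  have hf0 : fourierLaplace f 0 = ((c * k : ℝ) : ℂ) := by
    rw [fourierLaplace_zero, integral_complex_ofReal, integral_const_mul, hk]
  have hA1 := integrable_windowAverage hf1
  have hA2 := memLp_two_of_bounded hA1 (norm_windowAverage_le hf1)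
  have hA : ∀ t, |t| ≤ a → f t + ε * windowAverage f t = c := fun t ht => by
    have h := heq t ht
    have hw : ∫ s in (t - 1)..(t + 1), f s = ((c * ∫ s in (t - 1)..(t + 1), φ s : ℝ) : ℂ) := by
      rw [← intervalIntegral.integral_const_mul]
      exact intervalIntegral.integral_ofReal
    rw [windowAverage, hw]
    have h' : c * φ t + ε * (1 / 2 * (c * ∫ s in (t - 1)..(t + 1), φ s)) = c := by
      linear_combination c * h
    have h'' := congrArg Complex.ofReal h'
    simp only [hf]
    push_cast at h'' ⊢
    exact h''
  have hmem : MemHilbert G (2 * a) (fourierLaplace f) :=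
    (memHilbert_iff hG hε ha.le).2 ⟨f, hf2, hfs, rfl⟩
  have hrep : ∀ F, MemHilbert G (2 * a) F →
      F 0 = ∫ x : ℝ, F x * conj (fourierLaplace f x) ∂(densityMeasure G) := by
    intro F hF
    obtain ⟨g, hg2, hgs, rfl⟩ := (memHilbert_iff hG hε ha.le).1 hF
    have hg1 := integrable_of_memLp_of_support hg2 hgs
    have hi1 : Integrable fun x : ℝ => fourierLaplace g x * conj (fourierLaplace f x) :=
      (memLp_fourierLaplace hg1 hg2).integrable_mul (memLp_fourierLaplace hf1 hf2).star
    have hi2 : Integrable fun x : ℝ =>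
        fourierLaplace g x * conj (fourierLaplace (windowAverage f) x) :=
      (memLp_fourierLaplace hg1 hg2).integrable_mul (memLp_fourierLaplace hA1 hA2).star
    have hpt : (fun x : ℝ => sincWeight ε x • (fourierLaplace g x * conj (fourierLaplace f x)))
        = fun x : ℝ => fourierLaplace g x * conj (fourierLaplace f x)
          + ε * (fourierLaplace g x * conj (fourierLaplace (windowAverage f) x)) := by
      funext x
      rw [fourierLaplace_windowAverage hf1, map_mul, Complex.conj_ofReal, Complex.real_smul,
        sincWeight]
      push_cast
      ring
    have hj1 : Integrable fun t => g t * conj (f t) := hg2.integrable_mul hf2.star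
    have hj2 : Integrable fun t => g t * conj (windowAverage f t) := hg2.integrable_mul hA2.star
    rw [hG, integral_weightMeasure hε (integrable_sincWeight_smul hε hi1), hpt,
      integral_add hi1 (hi2.const_mul _), integral_const_mul,
      integral_fourierLaplace_mul_conj hg1 hg2 hf1 hf2,
      integral_fourierLaplace_mul_conj hg1 hg2 hA1 hA2, ← integral_const_mul,
      ← integral_add hj1 (hj2.const_mul _)]
    -- The integral equation is needed only on [-a, a], because g vanishes elsewhere.
    have hpt2 : (fun t => g t * conj (f t) + ε * (g t * conj (windowAverage f t)))
        = fun t => g t * c := by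
      funext t
      by_cases ht : a < |t|
      · simp [hgs t ht]
      · have h := congrArg conj (hA t (not_lt.1 ht))
        rw [map_add, map_mul, Complex.conj_ofReal ε, Complex.conj_ofReal c] at h
        linear_combination g t * h
    rw [hpt2, integral_mul_const, Complex.ofReal_zero, hf0, Complex.conj_ofReal, fourierLaplace_zero,
      Complex.real_smul]
    have hc2 : (c : ℂ) * (1 + (m : ℝ) * k) = 1 := by exact_mod_cast hc1
    push_cast
    linear_combination -(∫ t, g t) * hc2
  have h := (isReproducingKernel_reproducingKernel G (mul_pos two_pos ha)).conj_symm hmem hrep 0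
  rw [h, hf0, Complex.conj_ofReal]
  congr 1
  rw [hc, div_eq_inv_mul]

end

/-! ### Even profiles and the constant solution -/

/-- For 0 ≤ t ≤ a ≤ 1 the window meets [-a, a] in [-min(1 - t, a), a]; evenness folds the negative
part onto the positive axis. -/
theorem integral_indicator_window {ψ : ℝ → ℝ} (hψ : Continuous ψ) (heven : ∀ x, ψ (-x) = ψ x)
    {a t : ℝ} (ha0 : 0 ≤ a) (ha : a ≤ 1) (ht0 : 0 ≤ t) (hta : t ≤ a) :
    ∫ s in (t - 1)..(t + 1), Set.indicator (Set.Icc (-a) a) ψ s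
      = (∫ s in (0 : ℝ)..a, ψ s) + ∫ s in (0 : ℝ)..(min (1 - t) a), ψ s := by
  have hi : ∀ x y, IntervalIntegrable ψ volume x y := fun x y => hψ.intervalIntegrable x y
  set b := min (1 - t) a with hb
  have hb0 : 0 ≤ b := le_min (by linarith) ha0
  have hneg : ∫ s in (-b)..0, ψ s = ∫ s in (0 : ℝ)..b, ψ s := by
    have := intervalIntegral.integral_comp_neg (a := 0) (b := b) ψ
    simp only [heven, neg_zero] at this
    exact this.symm
  rw [add_comm (∫ s in (0 : ℝ)..a, ψ s), ← hneg, intervalIntegral.integral_add_adjacent_intervals (hi _ _) (hi _ _),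
    intervalIntegral.integral_of_le (by linarith), intervalIntegral.integral_of_le (by linarith),
    ← integral_Icc_eq_integral_Ioc, ← integral_Icc_eq_integral_Ioc,
    setIntegral_indicator measurableSet_Icc]
  congr 2
  rw [Set.Icc_inter_Icc]
  congr 1
  · rw [hb, ← max_neg_neg]
    congr 1
    ring
  · exact min_eq_right (by linarith)

/-- The kernel value at the origin for a profile given by an even continuous function. -/
theorem reproducingKernel_zero_zero_of_even {ε : ℝ} {m : NNReal} {G : SymmetryGroup}
    (hG : densityMeasure G = weightMeasure ε m) (hε : |ε| ≤ 1) {a : ℝ} (ha : 0 < a) (ha1 : a ≤ 1)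
    {ψ : ℝ → ℝ} (hψ : Continuous ψ) (heven : ∀ x, ψ (-x) = ψ x) {D : ℝ} (hD : 0 < D)
    (heq : ∀ t, 0 ≤ t → t ≤ a →
      ψ t + ε / 2 * ((∫ s in (0 : ℝ)..a, ψ s) + ∫ s in (0 : ℝ)..(min (1 - t) a), ψ s) = D)
    (hk : 0 ≤ ∫ s in (0 : ℝ)..a, ψ s) :
    reproducingKernel G (2 * a) 0 0 =
      (((2 * (∫ s in (0 : ℝ)..a, ψ s) / D) /
        (1 + m * (2 * (∫ s in (0 : ℝ)..a, ψ s) / D)) : ℝ) : ℂ) := by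
  set χ := Set.indicator (Set.Icc (-a) a) ψ with hχ
  have hχs : ∀ t, a < |t| → χ t = 0 := fun t ht =>
    Set.indicator_of_notMem (fun h : t ∈ Set.Icc (-a) a => not_le.2 ht (abs_le.2 h)) _
  have hχe : ∀ t, χ (-t) = χ t := fun t => by
    by_cases ht : t ∈ Set.Icc (-a) a
    · have ht' : -t ∈ Set.Icc (-a) a := ⟨by linarith [ht.2], by linarith [ht.1]⟩
      rw [hχ, Set.indicator_of_mem ht, Set.indicator_of_mem ht', heven]
    · have ht' : -t ∉ Set.Icc (-a) a := fun h => ht ⟨by linarith [h.2], by linarith [h.1]⟩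
      rw [hχ, Set.indicator_of_notMem ht, Set.indicator_of_notMem ht']
  have hχi : Integrable χ := (integrable_indicator_iff measurableSet_Icc).2
    hψ.continuousOn.integrableOn_Icc
  obtain ⟨B, hB⟩ := isCompact_Icc.exists_bound_of_continuousOn (s := Set.Icc (-a) a)
    hψ.continuousOn
  have hχB : ∀ t, |χ t| ≤ B := fun t => by
    by_cases ht : t ∈ Set.Icc (-a) a
    · rw [hχ, Set.indicator_of_mem ht]
      exact hB t ht
    · rw [hχ, Set.indicator_of_notMem ht, abs_zero]
      exact (norm_nonneg _).trans (hB 0 ⟨by linarith, ha.le⟩)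
  have hχeq : ∀ t, 0 ≤ t → t ≤ a → χ t + ε / 2 * ∫ s in (t - 1)..(t + 1), χ s = D := by
    intro t ht0 hta
    rw [hχ, integral_indicator_window hψ heven ha.le ha1 ht0 hta,
      Set.indicator_of_mem (show t ∈ Set.Icc (-a) a from ⟨by linarith, hta⟩)]
    exact heq t ht0 hta
  have hχint : ∫ t, χ t = 2 * ∫ s in (0 : ℝ)..a, ψ s := by
    have h := integral_indicator_window hψ heven ha.le ha1 le_rfl ha.le
    rw [sub_zero, min_eq_right ha1, ← two_mul, zero_sub, zero_add] at h
    rw [← h, intervalIntegral.integral_of_le (by norm_num), ← integral_Icc_eq_integral_Ioc, eq_comm]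
    refine setIntegral_eq_integral_of_forall_compl_eq_zero fun t ht => hχs t ?_
    by_contra! h
    exact ht (abs_le.1 (h.trans ha1))
  -- Dividing by D normalises the right-hand side of the integral equation to 1.
  refine reproducingKernel_zero_zero hG hε ha (φ := fun t => D⁻¹ * χ t) (B := D⁻¹ * B)
    (hχi.const_mul _) (fun t => ?_) (fun t ht => by rw [hχs t ht, mul_zero]) (fun t ht => ?_) ?_
    (by positivity)
  · rw [abs_mul, abs_of_pos (inv_pos.2 hD)]
    have := hχB t
    gcongr
  · have key : χ t + ε / 2 * ∫ s in (t - 1)..(t + 1), χ s = D := by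
      rcases le_total 0 t with h0 | h0
      · exact hχeq t h0 ((le_abs_self t).trans ht)
      · have h := hχeq (-t) (by linarith) ((neg_le_abs t).trans ht)
        rw [hχe] at h
        rw [← h]
        have h2 := intervalIntegral.integral_comp_neg (a := t - 1) (b := t + 1) χ
        simp only [hχe] at h2
        rw [h2]
        congr 3 <;> ring
    rw [intervalIntegral.integral_const_mul]
    have : D⁻¹ * D = 1 := inv_mul_cancel₀ hD.ne'
    linear_combination D⁻¹ * key + this
  · rw [integral_const_mul, hχint]
    ring

/-- When Δ ≤ 1, each window centred in [-Δ/2, Δ/2] contains that whole interval, so the averaging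
term is constant and so is the solution. -/
theorem reproducingKernel_of_const {ε : ℝ} {m : NNReal} {G : SymmetryGroup}
    (hG : densityMeasure G = weightMeasure ε m) (hε : |ε| ≤ 1) {Δ : ℝ} (hΔ : 0 < Δ) (hΔ1 : Δ ≤ 1) :
    reproducingKernel G Δ 0 0 =
      (((2 * Δ / (2 + ε * Δ)) / (1 + m * (2 * Δ / (2 + ε * Δ))) : ℝ) : ℂ) := by
  have hε1 := (abs_le.1 hε).1
  have hpos : 0 < 1 + ε * (Δ / 2) := by nlinarith
  have h := reproducingKernel_zero_zero_of_even hG hε (half_pos hΔ) (by linarith)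
    (ψ := fun _ => 1) continuous_const (fun _ => rfl) hpos
    (fun t ht0 hta => by
      rw [min_eq_right (by linarith)]
      simp only [intervalIntegral.integral_const, smul_eq_mul]
      ring)
    (by simp only [intervalIntegral.integral_const, smul_eq_mul]; linarith)
  rw [mul_div_cancel₀ _ two_ne_zero] at h
  rw [h]
  have e : 2 * (∫ _ in (0 : ℝ)..(Δ / 2), (1 : ℝ)) / (1 + ε * (Δ / 2)) = 2 * Δ / (2 + ε * Δ) := by
    have : 0 < 2 + ε * Δ := by linarith
    simp only [intervalIntegral.integral_const, smul_eq_mul]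
    field_simp
    ring
  rw [e]

/-- The kernel value at the origin for a measure `dx + m δ₀`. -/
theorem reproducingKernel_of_weight_zero {m : NNReal} {G : SymmetryGroup}
    (hG : densityMeasure G = weightMeasure 0 m) {Δ : ℝ} (hΔ : 0 < Δ) :
    reproducingKernel G Δ 0 0 = ((Δ / (1 + m * Δ) : ℝ) : ℂ) := by
  have h := reproducingKernel_zero_zero hG (by simp) (half_pos hΔ)
    (φ := Set.indicator (Set.Icc (-(Δ / 2)) (Δ / 2)) fun _ => 1) (B := 1)
    ((integrable_indicator_iff measurableSet_Icc).2 (by simp))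
    (fun t => by
      by_cases ht : t ∈ Set.Icc (-(Δ / 2)) (Δ / 2)
      · rw [Set.indicator_of_mem ht]; simp
      · rw [Set.indicator_of_notMem ht]; simp)
    (fun t ht => Set.indicator_of_notMem
      (fun h : t ∈ Set.Icc (-(Δ / 2)) (Δ / 2) => not_le.2 ht (abs_le.2 h)) _)
    (fun t ht => by
      rw [Set.indicator_of_mem (show t ∈ Set.Icc (-(Δ / 2)) (Δ / 2) from abs_le.1 ht)]
      simp)
    (k := Δ) (by
      rw [integral_indicator measurableSet_Icc]
      simp [hΔ.le]) hΔ.le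
  rwa [mul_div_cancel₀ _ two_ne_zero] at h

/-! ### The reflected equation and the range 1 < Δ ≤ 2 -/

/-- The solution `cos(s/2) + ε sin(s/2)` of the reflected equation `p'(s) = (ε/2) p(-s)`. -/
noncomputable def reflectedSolution (ε s : ℝ) : ℝ := Real.cos (s / 2) + ε * Real.sin (s / 2)

theorem continuous_reflectedSolution (ε : ℝ) : Continuous (reflectedSolution ε) := by
  unfold reflectedSolution
  fun_prop

theorem hasDerivAt_reflectedSolution {ε : ℝ} (hε : ε ^ 2 = 1) (s : ℝ) :
    HasDerivAt (reflectedSolution ε) (ε / 2 * reflectedSolution ε (-s)) s := by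
  have h1 : HasDerivAt (fun s : ℝ => s / 2) (1 / 2) s := (hasDerivAt_id s).div_const 2
  have h := h1.cos.add (h1.sin.const_mul ε)
  refine h.congr_deriv ?_
  rw [reflectedSolution, neg_div, Real.cos_neg, Real.sin_neg]
  linear_combination (Real.sin (s / 2) / 2) * hε

/-- By the reflected equation and ε² = 1, the function -2ε r(1/2 - s) is an antiderivative of r(s -
1/2). -/
theorem integral_reflectedSolution {ε : ℝ} (hε : ε ^ 2 = 1) (b x : ℝ) :
    ∫ s in b..x, reflectedSolution ε (s - 1 / 2)
      = 2 * ε * (reflectedSolution ε (1 / 2 - b) - reflectedSolution ε (1 / 2 - x)) := by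
  rw [intervalIntegral.integral_eq_sub_of_hasDerivAt
    (f := fun s => -(2 * ε) * reflectedSolution ε (1 / 2 - s))]
  · ring
  · intro s _
    have h1 : HasDerivAt (fun s : ℝ => 1 / 2 - s) (-1) s := (hasDerivAt_id s).const_sub (1 / 2)
    have h := ((hasDerivAt_reflectedSolution hε (1 / 2 - s)).comp s h1).const_mul (-(2 * ε))
    refine h.congr_deriv ?_
    rw [neg_sub]
    linear_combination reflectedSolution ε (s - 1 / 2) * hε
  · exact ((continuous_reflectedSolution ε).comp (by fun_prop)).intervalIntegrable _ _

theorem integral_profile {ε a x : ℝ} (hε : ε ^ 2 = 1) (ha1 : a ≤ 1) (hx : 1 - a ≤ x) :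
    ∫ s in (0 : ℝ)..x, reflectedSolution ε (max |s| (1 - a) - 1 / 2)
      = (1 - a) * reflectedSolution ε (1 / 2 - a)
        + 2 * ε * (reflectedSolution ε (a - 1 / 2) - reflectedSolution ε (1 / 2 - x)) := by
  have hc : Continuous fun s : ℝ => reflectedSolution ε (max |s| (1 - a) - 1 / 2) :=
    (continuous_reflectedSolution ε).comp (by fun_prop)
  rw [← intervalIntegral.integral_add_adjacent_intervals (b := 1 - a)
    (hc.intervalIntegrable _ _) (hc.intervalIntegrable _ _)]
  congr 1
  · rw [intervalIntegral.integral_congr (g := fun _ => reflectedSolution ε (1 / 2 - a))]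
    · simp
    · intro s hs
      rw [Set.uIcc_of_le (by linarith)] at hs
      simp only
      rw [abs_of_nonneg hs.1, max_eq_right hs.2]
      congr 1
      ring
  · rw [intervalIntegral.integral_congr (g := fun s => reflectedSolution ε (s - 1 / 2)),
      integral_reflectedSolution hε]
    · congr 3
      ring
    · intro s hs
      rw [Set.uIcc_of_le hx] at hs
      simp only
      rw [abs_of_nonneg (by linarith [hs.1]), max_eq_left hs.1]

/-- Windows centred at |t| ≤ 1 - a cover the whole band, so the profile is flat there, with value p,
and the equation reads D = p + εP, where P is the integral over [0, a]. The maximum with 1 - a glues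
this plateau continuously to the reflected solution on 1 - a ≤ |t| ≤ a. -/
theorem reproducingKernel_of_profile {ε : ℝ} (hε : ε ^ 2 = 1) {m : NNReal} {G : SymmetryGroup}
    (hG : densityMeasure G = weightMeasure ε m) {a : ℝ} (ha : 1 / 2 < a) (ha1 : a ≤ 1)
    {p q P : ℝ} (hp : reflectedSolution ε (1 / 2 - a) = p)
    (hq : reflectedSolution ε (a - 1 / 2) = q)
    (hP : (1 - a) * p + 2 * ε * (q - p) = P) (hP0 : 0 ≤ P) (hD : 0 < p + ε * P) :
    reproducingKernel G (2 * a) 0 0 =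
      (((2 * P / (p + ε * P)) / (1 + m * (2 * P / (p + ε * P))) : ℝ) : ℂ) := by
  have hint : ∫ s in (0 : ℝ)..a, reflectedSolution ε (max |s| (1 - a) - 1 / 2) = P := by
    rw [integral_profile hε ha1 (by linarith), hp, hq, hP]
  have h := reproducingKernel_zero_zero_of_even hG ((sq_le_one_iff_abs_le_one ε).1 hε.le) (by linarith)
    ha1 (ψ := fun s => reflectedSolution ε (max |s| (1 - a) - 1 / 2))
    ((continuous_reflectedSolution ε).comp (by fun_prop)) (fun x => by simp only [abs_neg]) hD
    (fun t ht0 hta => ?_) (by rw [hint]; exact hP0)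
  · rwa [hint] at h
  · rw [hint]
    rcases le_total t (1 - a) with h1 | h1
    · rw [min_eq_right (by linarith), hint, abs_of_nonneg ht0, max_eq_right h1,
        show 1 - a - 1 / 2 = 1 / 2 - a by ring, hp]
      ring
    · rw [min_eq_left (by linarith), abs_of_nonneg ht0, max_eq_left h1,
        integral_profile hε ha1 (by linarith), hp, hq,
        show 1 / 2 - (1 - t) = t - 1 / 2 by ring]
      linear_combination ε / 2 * hP + (p - reflectedSolution ε (t - 1 / 2)) * hε

/-- Used at x = (Δ - 1)/4, which is at most 1/4 for Δ ≤ 2. -/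
theorem half_angle_bounds {x : ℝ} (hx0 : 0 < x) (hx : x ≤ 1 / 4) :
    0 < Real.sin x ∧ Real.sin x ≤ x ∧ 1 - x ^ 2 / 2 ≤ Real.cos x ∧ Real.sin x < Real.cos x :=
  have h1 := Real.sin_pos_of_pos_of_lt_pi hx0 (by linarith [Real.pi_gt_three])
  have h2 := Real.sin_le hx0.le
  have h3 := Real.one_sub_sq_div_two_le_cos (x := x)
  ⟨h1, h2, h3, by nlinarith⟩

theorem cos_sin_double {θ : ℝ} :
    Real.cos θ = Real.cos (θ / 2) ^ 2 - Real.sin (θ / 2) ^ 2 ∧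
      Real.sin θ = 2 * Real.sin (θ / 2) * Real.cos (θ / 2) := by
  have h1 := Real.cos_two_mul' (θ / 2)
  have h2 := Real.sin_two_mul (θ / 2)
  rw [mul_div_cancel₀ _ two_ne_zero] at h1 h2
  exact ⟨h1, h2⟩

/-- The kernel value at the origin for the weight `1 + sin(2πx)/(2πx)` and `1 < Δ ≤ 2`. -/
theorem reproducingKernel_SOeven {Δ : ℝ} (h1 : 1 < Δ) (h2 : Δ ≤ 2) :
    reproducingKernel .SOeven Δ 0 0 =
      ((2 - 4 * Real.cos ((Δ - 1) / 2) /
        (4 + 4 * Real.sin ((Δ - 1) / 2) - Δ * Real.cos ((Δ - 1) / 2)) : ℝ) : ℂ) := by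
  set θ := (Δ - 1) / 2 with hθ
  obtain ⟨a, rfl⟩ : ∃ a, Δ = 2 * a := ⟨Δ / 2, by ring⟩
  obtain ⟨hS, -, hC, hSC⟩ := half_angle_bounds (x := θ / 2) (by linarith) (by linarith)
  obtain ⟨hcos, hsin⟩ := cos_sin_double (θ := θ)
  have hsq := Real.sin_sq_add_cos_sq (θ / 2)
  set S := Real.sin (θ / 2)
  set C := Real.cos (θ / 2)
  have hp : reflectedSolution 1 (1 / 2 - a) = C - S := by
    rw [reflectedSolution, show (1 / 2 - a) / 2 = -(θ / 2) by rw [hθ]; ring, Real.cos_neg,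
      Real.sin_neg]
    ring
  have hq : reflectedSolution 1 (a - 1 / 2) = C + S := by
    rw [reflectedSolution, show (a - 1 / 2) / 2 = θ / 2 by rw [hθ]; ring, one_mul]
  have hP0 : 0 ≤ (1 - a) * (C - S) + 4 * S := by nlinarith
  have hD : 0 < (C - S) + 1 * ((1 - a) * (C - S) + 4 * S) := by nlinarith
  rw [reproducingKernel_of_profile (one_pow 2) densityMeasure_SOeven (by linarith) (by linarith)
    hp hq (P := (1 - a) * (C - S) + 4 * S) (by ring) hP0 hD]
  congr 1
  -- The target denominator is 2D(C + S) and cos θ = (C - S)(C + S), so the common factor C + S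
  -- cancels.
  have hE : 4 + 4 * Real.sin θ - 2 * a * Real.cos θ
      = 2 * (((C - S) + 1 * ((1 - a) * (C - S) + 4 * S)) * (C + S)) := by
    rw [hcos, hsin]
    linear_combination -4 * hsq
  have hne : C + S ≠ 0 := by linarith
  rw [hE, hcos]
  simp only [NNReal.coe_zero, zero_mul, add_zero, div_one]
  generalize hDe : (C - S) + 1 * ((1 - a) * (C - S) + 4 * S) = D at hD
  have hD' := hD.ne'
  field_simp
  rw [← hDe]
  ring

/-- The kernel value at the origin for the measures `(1 - sin(2πx)/(2πx)) dx + m δ₀` and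
`1 < Δ ≤ 2`. -/
theorem reproducingKernel_of_neg_one {Δ : ℝ} (h1 : 1 < Δ) (h2 : Δ ≤ 2) {m : NNReal}
    {G : SymmetryGroup} (hG : densityMeasure G = weightMeasure (-1) m) :
    ∃ k, 0 ≤ k ∧ 0 < 4 - 4 * Real.sin ((Δ - 1) / 2) - (4 - Δ) * Real.cos ((Δ - 1) / 2) ∧
      k = 4 * Real.cos ((Δ - 1) / 2) /
        (4 - 4 * Real.sin ((Δ - 1) / 2) - (4 - Δ) * Real.cos ((Δ - 1) / 2)) - 2 ∧
      reproducingKernel G Δ 0 0 = ((k / (1 + m * k) : ℝ) : ℂ) := by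
  set θ := (Δ - 1) / 2 with hθ
  obtain ⟨a, rfl⟩ : ∃ a, Δ = 2 * a := ⟨Δ / 2, by ring⟩
  obtain ⟨hS, hSx, hC, hSC⟩ := half_angle_bounds (x := θ / 2) (by linarith) (by linarith)
  obtain ⟨hcos, hsin⟩ := cos_sin_double (θ := θ)
  have hsq := Real.sin_sq_add_cos_sq (θ / 2)
  set S := Real.sin (θ / 2)
  set C := Real.cos (θ / 2)
  have hp : reflectedSolution (-1) (1 / 2 - a) = C + S := by
    rw [reflectedSolution, show (1 / 2 - a) / 2 = -(θ / 2) by rw [hθ]; ring, Real.cos_neg,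
      Real.sin_neg]
    ring
  have hq : reflectedSolution (-1) (a - 1 / 2) = C - S := by
    rw [reflectedSolution, show (a - 1 / 2) / 2 = θ / 2 by rw [hθ]; ring]
    ring
  have hP0 : 0 ≤ (1 - a) * (C + S) + 4 * S := by nlinarith
  have hD : 0 < (C + S) + (-1) * ((1 - a) * (C + S) + 4 * S) := by
    -- The normalising constant is aC - (4 - a)S. In terms of x = θ/2 it is bounded below using C ≥
    -- 1 - x²/2 and S ≤ x, which leaves a polynomial positive on (0, 1/4].
    have ha : a = 2 * (θ / 2) + 1 / 2 := by rw [hθ]; ring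
    set x := θ / 2
    have hx0 : 0 < x := by linarith
    have hx1 : x ≤ 1 / 4 := by linarith
    have e1 : (1 - x ^ 2 / 2) * (2 * x + 1 / 2) ≤ C * (2 * x + 1 / 2) := by gcongr
    have e2 : (7 / 2 - 2 * x) * S ≤ (7 / 2 - 2 * x) * x :=
      mul_le_mul_of_nonneg_left hSx (by linarith)
    have e3 : 0 < (1 - x ^ 2 / 2) * (2 * x + 1 / 2) - (7 / 2 - 2 * x) * x := by
      nlinarith [mul_nonneg (mul_nonneg hx0.le hx0.le) (sub_nonneg.2 hx1)]
    rw [ha]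
    nlinarith
  have hE : 4 - 4 * Real.sin θ - (4 - 2 * a) * Real.cos θ
      = 2 * (((C + S) + (-1) * ((1 - a) * (C + S) + 4 * S)) * (C - S)) := by
    rw [hcos, hsin]
    linear_combination -4 * hsq
  have hne : 0 < C - S := by linarith
  refine ⟨2 * ((1 - a) * (C + S) + 4 * S) / ((C + S) + (-1) * ((1 - a) * (C + S) + 4 * S)),
    by positivity, by rw [hE]; positivity, ?_,
    reproducingKernel_of_profile (by norm_num) hG (by linarith) (by linarith) hp hq (by ring)
      hP0 hD⟩
  rw [hE, hcos]
  generalize hDe : (C + S) + (-1) * ((1 - a) * (C + S) + 4 * S) = D at hD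
  have hD' := hD.ne'
  have hne' := hne.ne'
  field_simp
  rw [← hDe]
  ring

theorem reproducingKernel_Sp {Δ : ℝ} (h1 : 1 < Δ) (h2 : Δ ≤ 2) :
    reproducingKernel .Sp Δ 0 0 =
      ((4 * Real.cos ((Δ - 1) / 2) /
        (4 - 4 * Real.sin ((Δ - 1) / 2) - (4 - Δ) * Real.cos ((Δ - 1) / 2)) - 2 : ℝ) : ℂ) := by
  obtain ⟨k, -, -, hk, h⟩ := reproducingKernel_of_neg_one h1 h2 densityMeasure_Sp
  rw [h, ← hk]
  simp

theorem reproducingKernel_SOodd {Δ : ℝ} (h1 : 1 < Δ) (h2 : Δ ≤ 2) :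
    reproducingKernel .SOodd Δ 0 0 =
      ((2 + 4 * Real.cos ((Δ - 1) / 2) /
        (4 - 4 * Real.sin ((Δ - 1) / 2) - (8 - Δ) * Real.cos ((Δ - 1) / 2)) : ℝ) : ℂ) := by
  obtain ⟨k, hk0, hE, hk, h⟩ := reproducingKernel_of_neg_one h1 h2 densityMeasure_SOodd
  rw [h]
  congr 1
  set c := Real.cos ((Δ - 1) / 2)
  set E := 4 - 4 * Real.sin ((Δ - 1) / 2) - (4 - Δ) * c with hEdef
  have e : 4 - 4 * Real.sin ((Δ - 1) / 2) - (8 - Δ) * c = E - 4 * c := by rw [hEdef]; ring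
  -- Hence E - 4c = -(1 + k)E, and 2 + 4c/(E - 4c) = 2 - (k + 2)/(1 + k) = k/(1 + k), the value
  -- corrected for an atom of mass 1.
  have hkE : (k + 2) * E = 4 * c := by rw [hk]; field_simp; ring
  have e2 : E - 4 * c = -((1 + k) * E) := by linear_combination hkE
  have hk1 : 1 + k ≠ 0 := by linarith
  rw [e, e2, ← hkE, NNReal.coe_one, one_mul]
  field_simp
  ring

theorem corollary8 :
    -- the kernels exist and are unique, so that `reproducingKernel` is the kernel of the space
    (∀ (G : SymmetryGroup) (Δ : ℝ), 0 < Δ → ∃! K : ℂ → ℂ → ℂ, IsReproducingKernel G Δ K) ∧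
    -- unitary and orthogonal symmetry
    (∀ Δ : ℝ, 0 < Δ →
      reproducingKernel .U Δ 0 0 = ((Δ : ℝ) : ℂ) ∧
      reproducingKernel .O Δ 0 0 = ((2 * Δ / (2 + Δ) : ℝ) : ℂ)) ∧
    -- even orthogonal symmetry
    (∀ Δ : ℝ, 0 < Δ → Δ ≤ 1 →
      reproducingKernel .SOeven Δ 0 0 = ((2 * Δ / (2 + Δ) : ℝ) : ℂ)) ∧
    (∀ Δ : ℝ, 1 < Δ → Δ ≤ 2 →
      reproducingKernel .SOeven Δ 0 0 =
        ((2 - 4 * Real.cos ((Δ - 1) / 2) /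
          (4 + 4 * Real.sin ((Δ - 1) / 2) - Δ * Real.cos ((Δ - 1) / 2)) : ℝ) : ℂ)) ∧
    -- symplectic symmetry
    (∀ Δ : ℝ, 0 < Δ → Δ ≤ 1 →
      reproducingKernel .Sp Δ 0 0 = ((2 * Δ / (2 - Δ) : ℝ) : ℂ)) ∧
    (∀ Δ : ℝ, 1 < Δ → Δ ≤ 2 →
      reproducingKernel .Sp Δ 0 0 =
        ((4 * Real.cos ((Δ - 1) / 2) /
          (4 - 4 * Real.sin ((Δ - 1) / 2) - (4 - Δ) * Real.cos ((Δ - 1) / 2)) - 2 : ℝ) : ℂ)) ∧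
    -- odd orthogonal symmetry
    (∀ Δ : ℝ, 0 < Δ → Δ ≤ 1 →
      reproducingKernel .SOodd Δ 0 0 = ((2 * Δ / (2 + Δ) : ℝ) : ℂ)) ∧
    (∀ Δ : ℝ, 1 < Δ → Δ ≤ 2 →
      reproducingKernel .SOodd Δ 0 0 =
        ((2 + 4 * Real.cos ((Δ - 1) / 2) /
          (4 - 4 * Real.sin ((Δ - 1) / 2) - (8 - Δ) * Real.cos ((Δ - 1) / 2)) : ℝ) : ℂ)) := by
  refine ⟨fun G Δ hΔ => existsUnique_isReproducingKernel G hΔ, fun Δ hΔ => ⟨?_, ?_⟩,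
    fun Δ hΔ hΔ1 => ?_, fun Δ => reproducingKernel_SOeven, fun Δ hΔ hΔ1 => ?_,
    fun Δ => reproducingKernel_Sp, fun Δ hΔ hΔ1 => ?_, fun Δ => reproducingKernel_SOodd⟩
  · rw [reproducingKernel_of_weight_zero densityMeasure_U hΔ]
    simp
  · rw [reproducingKernel_of_weight_zero densityMeasure_O hΔ]
    congr 1
    push_cast
    field_simp
  · rw [reproducingKernel_of_const densityMeasure_SOeven (by simp) hΔ hΔ1]
    simp
  · rw [reproducingKernel_of_const densityMeasure_Sp (by simp) hΔ hΔ1]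
    simp [sub_eq_add_neg]
  · rw [reproducingKernel_of_const densityMeasure_SOodd (by simp) hΔ hΔ1]
    congr 1
    have h1 : 2 + -1 * Δ ≠ 0 := by linarith
    rw [NNReal.coe_one, one_mul]
    have h3 : 1 + 2 * Δ / (2 + -1 * Δ) = (2 + Δ) / (2 + -1 * Δ) := by
      rw [eq_div_iff h1, add_mul, div_mul_cancel₀ _ h1]
      ring
    rw [h3, div_div_div_cancel_right₀ h1]
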